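/- **Setting.** Let $\alpha,\beta,\Gamma:[0,1]\to\mathbb R$ be such that $\alpha$, $\beta$ and $\sqrt\Gamma$ are Hölder continuous (each for some positive exponent) and $\Gamma(t)>0$ for all $t\in[0,1]$. For $a\in\{\alpha,\beta\}$ put $$g_a(t)=e^{\int_0^t a(v)\,dv},\qquad f_a(t)=\sqrt{\Gamma(t)}\,e^{-\int_0^t a(v)\,dv},\qquad h_a(s,t)=\int_s^t f_a(u)^2\,du,\qquad h_a(t)=h_a(0,t).$$ *Supports.* Let $\mathcal I=\{(0,0)\}\cup\{(n,k): n\ge 1,\ 0\le k<2^{n-1}\}$. For $n\ge1$ and $0\le k<2^{n-1}$ let $l_{n,k}<m_{n,k}<r_{n,k}$ be reals with $l_{1,0}=0$, $r_{1,0}=1$, $l_{n+1,2k}=l_{n,k}$, $r_{n+1,2k}=m_{n,k}=l_{n+1,2k+1}$, $r_{n+1,2k+1}=r_{n,k}$, and such that for some $\rho\in(0,1)$ one has $\max(r_{n,k}-m_{n,k},\,m_{n,k}-l_{n,k})<\rho\,(r_{n,k}-l_{n,k})$ for all $(n,k)$, $n\ge 1$. *Bases.* For $n\ge1$, writing $l,m,r$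 for $l_{n,k},m_{n,k},r_{n,k}$, let $${}_a\sigma_{n,k}=g_a(m)\sqrt{\frac{h_a(l,m)\,h_a(m,r)}{h_a(l,r)}},\quad {}_aL_{n,k}=\frac{{}_a\sigma_{n,k}}{g_a(m)h_a(l,m)},\quad {}_aR_{n,k}=\frac{{}_a\sigma_{n,k}}{g_a(m)h_a(m,r)},\quad {}_aM_{n,k}=\frac{g_a(m)}{{}_a\sigma_{n,k}},$$ and let ${}_aL_{0,0}=h_a(1)^{-1/2}$. Define ${}_a\psi_{0,0}(t)=g_a(t)h_a(t)\,{}_aL_{0,0}$ and ${}_a\phi_{0,0}(t)=f_a(t)\,{}_aL_{0,0}$ on $[0,1]$, and for $n\ge 1$ $${}_a\psi_{n,k}(t)=\begin{cases} g_a(t)h_a(l,t)\,{}_aL_{n,k}, & l\le t\le m,\\ g_a(t)h_a(t,r)\,{}_aR_{n,k}, & m\le t\le r,\\ 0,&\text{otherwise},\end{cases}\qquad {}_a\phi_{n,k}(t)=\begin{cases} f_a(t)\,{}_aL_{n,k}, & l\le t< m,\\ -f_a(t)\,{}_aR_{n,k}, & m\le t< r,\\ 0,&\text{otherwise}.\end{cases}$$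 *Operators.* For $\xi\in\ell^2(\mathcal I)$ let ${}_a\Psi(\xi)(t)=\sum_{(n,k)\in\mathcal I}{}_a\psi_{n,k}(t)\,\xi_{n,k}$, and for a continuous function $x$ on $[0,1]$ let $${}_a\Delta(x)_{0,0}={}_aL_{0,0}\frac{x(1)}{g_a(1)},\qquad {}_a\Delta(x)_{n,k}={}_aM_{n,k}\frac{x(m_{n,k})}{g_a(m_{n,k})}-{}_aL_{n,k}\frac{x(l_{n,k})}{g_a(l_{n,k})}-{}_aR_{n,k}\frac{x(r_{n,k})}{g_a(r_{n,k})}\quad(n\ge1).$$ **Theorem.** For every $\xi\in\ell^2(\mathcal I)$ the series ${}_\alpha\Psi(\xi)$ converges (unconditionally) uniformly on $[0,1]$, and $G={}_\beta\Delta\circ{}_\alpha\Psi$ is a bounded linear operator $\ell^2(\mathcal I)\to\ell^2(\mathcal I)$. Let $S=G^{T}G$. Then: 1. $S-\mathrm{Id}$ is a trace class operator on $\ell^2(\mathcal I)$, with trace (the sum of the diagonal entries in any orthonormal basis) $$\mathrm{Tr}(S-\mathrm{Id})=\int_0^1\big(\alpha(t)-\beta(t)\big)\,dt+\int_0^1\frac{h_\alpha(t)}{f_\alpha(t)^2}\big(\alpha(t)-\beta(t)\big)^2\,dt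 .$$ 2. The map $\Phi(\xi)=\sum_{(n,k)\in\mathcal I}{}_\alpha\phi_{n,k}\,\xi_{n,k}$ (convergence in $L^2[0,1]$) is a linear isometry of $\ell^2(\mathcal I)$ onto $L^2[0,1]$, and $S-\mathrm{Id}=\Phi^{-1}\circ R\circ\Phi$, where $R$ is the bounded operator on $L^2[0,1]$ given by $R[x](t)=\int_0^1R(t,s)\,x(s)\,ds$ with kernel $$R(t,s)=\big(\alpha(t\vee s)-\beta(t\vee s)\big)\frac{f_\alpha(t\wedge s)}{f_\alpha(t\vee s)}+f_\alpha(t)\left(\int_{t\vee s}^1\frac{(\alpha(u)-\beta(u))^2}{f_\alpha(u)^2}\,du\right)f_\alpha(s).$$ -/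

import Mathlib

open MeasureTheory Set Filter Topology
open scoped ENNReal NNReal

namespace GaussMarkov

noncomputable section

/-- A nested sequence of supports of `[0,1]`. The segment `[l n k, r n k]`, `k < 2 ^ n`, belongs to
generation `n + 1` of the binary tree (generation `1` is `[0,1]` itself), and `m n k` is its
subdivision point. Values at `k ≥ 2 ^ n` are irrelevant. -/
structure NestedPartition where
  l : ℕ → ℕ → ℝ
  m : ℕ → ℕ → ℝ
  r : ℕ → ℕ → ℝ
  l_root : l 0 0 = 0
  r_root : r 0 0 = 1
  l_left : ∀ n k, k < 2 ^ n → l (n + 1) (2 * k) = l n k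
  r_left : ∀ n k, k < 2 ^ n → r (n + 1) (2 * k) = m n k
  l_right : ∀ n k, k < 2 ^ n → l (n + 1) (2 * k + 1) = m n k
  r_right : ∀ n k, k < 2 ^ n → r (n + 1) (2 * k + 1) = r n k
  l_lt_m : ∀ n k, k < 2 ^ n → l n k < m n k
  m_lt_r : ∀ n k, k < 2 ^ n → m n k < r n k
  contraction : ∃ ρ : ℝ, 0 < ρ ∧ ρ < 1 ∧ ∀ n k, k < 2 ^ n →
    max (r n k - m n k) (m n k - l n k) < ρ * (r n k - l n k)

/-- The index set: `none` is the index `(0,0)`, and `some ⟨n, k⟩` is the index `(n + 1, k)`. -/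
abbrev Idx : Type := Option (Σ n : ℕ, Fin (2 ^ n))

/-- The Hilbert space of square-summable real families indexed by `Idx`. -/
abbrev L2Seq : Type := lp (fun _ : Idx => ℝ) 2

/-- The Hilbert space `L²[0,1]`. -/
abbrev L2Unit : Type := Lp ℝ 2 (volume.restrict (Icc (0 : ℝ) 1))

/-- Hölder continuity on `[0,1]` with some positive exponent. -/
def IsHolder (a : ℝ → ℝ) : Prop :=
  ∃ C δ : ℝ≥0, 0 < δ ∧ HolderOnWith C δ a (Icc (0 : ℝ) 1)

/-- `g_a(t) = exp (∫₀ᵗ a)`. -/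
def g (a : ℝ → ℝ) (t : ℝ) : ℝ := Real.exp (∫ v in (0 : ℝ)..t, a v)

/-- `f_a(t) = √Γ(t) exp (-∫₀ᵗ a)`. -/
def f (Γ a : ℝ → ℝ) (t : ℝ) : ℝ := √(Γ t) * Real.exp (-∫ v in (0 : ℝ)..t, a v)

/-- `h_a(s,t) = ∫ₛᵗ f_a²`. -/
def hInc (Γ a : ℝ → ℝ) (s t : ℝ) : ℝ := ∫ u in s..t, f Γ a u ^ 2

/-- `h_a(t) = h_a(0,t)`. -/
def h (Γ a : ℝ → ℝ) (t : ℝ) : ℝ := hInc Γ a 0 t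

/-- The conditional standard deviation at time `m` given the values at times `l` and `r`. -/
def sigma (Γ a : ℝ → ℝ) (l m r : ℝ) : ℝ :=
  g a m * √(hInc Γ a l m * hInc Γ a m r / hInc Γ a l r)

/-- The constant `L` of the segment `[l,r]` with subdivision point `m`. -/
def coefL (Γ a : ℝ → ℝ) (l m r : ℝ) : ℝ := sigma Γ a l m r / (g a m * hInc Γ a l m)

/-- The constant `R` of the segment `[l,r]` with subdivision point `m`. -/
def coefR (Γ a : ℝ → ℝ) (l m r : ℝ) : ℝ := sigma Γ a l m r / (g a m * hInc Γ a m r)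

/-- The constant `M` of the segment `[l,r]` with subdivision point `m`. -/
def coefM (Γ a : ℝ → ℝ) (l m r : ℝ) : ℝ := g a m / sigma Γ a l m r

/-- The constant `L` of the index `(0,0)`; `g(1) √h(1)` is the standard deviation at time `1`. -/
def coefL0 (Γ a : ℝ → ℝ) : ℝ := (g a 1 * √(h Γ a 1)) / (g a 1 * h Γ a 1)

/-- The Schauder functions `ψ_{n,k}`. -/
def psi (P : NestedPartition) (Γ a : ℝ → ℝ) : Idx → ℝ → ℝ
  | none, t => g a t * hInc Γ a 0 t * coefL0 Γ a
  | some ⟨n, k⟩, t =>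
      if P.l n k ≤ t ∧ t ≤ P.m n k then
        g a t * hInc Γ a (P.l n k) t * coefL Γ a (P.l n k) (P.m n k) (P.r n k)
      else if P.m n k ≤ t ∧ t ≤ P.r n k then
        g a t * hInc Γ a t (P.r n k) * coefR Γ a (P.l n k) (P.m n k) (P.r n k)
      else 0

/-- The orthonormal functions `φ_{n,k}`. -/
def phi (P : NestedPartition) (Γ a : ℝ → ℝ) : Idx → ℝ → ℝ
  | none, t => f Γ a t * coefL0 Γ a
  | some ⟨n, k⟩, t =>
      if P.l n k ≤ t ∧ t < P.m n k then
        f Γ a t * coefL Γ a (P.l n k) (P.m n k) (P.r n k)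
      else if P.m n k ≤ t ∧ t < P.r n k then
        -(f Γ a t * coefR Γ a (P.l n k) (P.m n k) (P.r n k))
      else 0

/-- The construction application `Ψ(ξ)(t) = ∑ ψ_{n,k}(t) ξ_{n,k}`. -/
def construction (P : NestedPartition) (Γ a : ℝ → ℝ) (ξ : Idx → ℝ) (t : ℝ) : ℝ :=
  ∑' i, psi P Γ a i t * ξ i

/-- The coefficient application `Δ(x)_{n,k} = (δ_{n,k}, x)`, where `δ_{n,k}` is the combination of
Dirac masses `g⁻¹ (M δ_m - L δ_l - R δ_r)`, and `g⁻¹ L δ_1` for the index `(0,0)`. -/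
def coefficient (P : NestedPartition) (Γ a : ℝ → ℝ) (x : ℝ → ℝ) : Idx → ℝ
  | none => coefL0 Γ a * ((g a 1)⁻¹ * x 1)
  | some ⟨n, k⟩ =>
      coefM Γ a (P.l n k) (P.m n k) (P.r n k) * ((g a (P.m n k))⁻¹ * x (P.m n k))
        - (coefL Γ a (P.l n k) (P.m n k) (P.r n k) * ((g a (P.l n k))⁻¹ * x (P.l n k))
          + coefR Γ a (P.l n k) (P.m n k) (P.r n k) * ((g a (P.r n k))⁻¹ * x (P.r n k)))

/-- The kernel `R(t,s)`. -/
def kernel (Γ α β : ℝ → ℝ) (t s : ℝ) : ℝ :=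
  (α (max t s) - β (max t s)) * (f Γ α (min t s) / f Γ α (max t s))
    + f Γ α t * (∫ u in (max t s)..1, (α u - β u) ^ 2 / f Γ α u ^ 2) * f Γ α s

/-- Trace class (that is, nuclear) operators of a Hilbert space: `T = ∑ ⟨a_n, ·⟩ b_n` for vectors
with `∑ ‖a_n‖ ‖b_n‖ < ∞`. -/
def IsTraceClass {E : Type*} [NormedAddCommGroup E] [InnerProductSpace ℝ E]
    (T : E →L[ℝ] E) : Prop :=
  ∃ a b : ℕ → E, Summable (fun n => ‖a n‖ * ‖b n‖) ∧
    ∀ x : E, HasSum (fun n => inner ℝ (a n) x • b n) (T x)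

/-- `τ` is the trace of `T`: the sum of the diagonal entries in every Hilbert basis. -/
def HasTrace {E : Type} [NormedAddCommGroup E] [InnerProductSpace ℝ E]
    (T : E →L[ℝ] E) (τ : ℝ) : Prop :=
  ∀ (ι : Type) (e : HilbertBasis ι ℝ E), HasSum (fun i => inner ℝ (e i) (T (e i))) τ

end

end GaussMarkov

/-! Everything is transported to L²[0,1]. For a drift a, let Φ_a(ξ) = ∑ φ_i ξ_i. Two identities link
the bases to L²: ψ_i(t) = g_a(t) ∫₀ᵗ f_a φ_i (`Regular.psi_eq`), and ⟨φ_i, z⟩ is the i-th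
coefficient Δ_a of the path g_a ∫₀ f_a z (`Regular.integral_phi_mul`). Together they say that ⟨φ_i,
φ_j⟩ = δ_i(ψ_j). This is zero for i ≠ j because the supports are nested, so φ is orthonormal; it is
complete because the division points are dense. Hence Ψ_a(ξ) is the path g_a ∫₀ f_a Φ_a(ξ), and Δ_a
inverts this construction.

Therefore G = Φ_β⁻¹ T Φ_α, where T sends x to the z such that g_β ∫₀ f_β z = g_α ∫₀ f_α x. Since f_β
= E f_α and g_α = E g_β with E = exp ∫₀(α - β), an integration by parts gives z = x + Kx for the
Volterra operator Kx(t) = ((α - β)/f_α)(t) ∫₀ᵗ f_α x (`g_mul_primitive_eq`). The isometry Φ_β drops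
out of GᵀG, so S - Id = Φ_α⁻¹ (K + Kᵀ + KᵀK) Φ_α, and the kernel of the bracket is R(t,s) = V(t ∨ s)
f_α(t) f_α(s) (`volterra_add_adjoint`, `kernel_eq`).

It remains to see that such a kernel is trace class with trace ∫ V f_α². The square is cut along its
diagonal into dyadic squares. Off the diagonal squares t ∨ s is a single coordinate, so each
generation n contributes 3·2ⁿ rank one operators, of size O(θⁿ 2⁻ⁿ) by Hölder continuity of V. These
are absolutely summable, and their traces telescope to the integral over the diagonal
(`DyadicData.isNuclearWithTrace_op`). A last integration by parts gives the stated formula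
(`integral_kernelProfile`). -/

namespace GaussMarkov

/-- Lebesgue measure on the unit interval. -/
local notation "μ₀" => Measure.restrict (volume : Measure ℝ) (Icc (0 : ℝ) 1)

/-! ### Geometry of the nested supports -/

namespace NestedPartition

variable (P : NestedPartition)

theorem l_lt_r {n k : ℕ} (hk : k < 2 ^ n) : P.l n k < P.r n k :=
  (P.l_lt_m n k hk).trans (P.m_lt_r n k hk)

/-- Every segment of generation `n + 1` is the left or right half of one of generation `n`. -/
theorem exists_parent {n k : ℕ} (hk : k < 2 ^ (n + 1)) :
    ∃ j < 2 ^ n, (k = 2 * j ∧ P.l (n + 1) k = P.l n j ∧ P.r (n + 1) k = P.m n j) ∨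
      (k = 2 * j + 1 ∧ P.l (n + 1) k = P.m n j ∧ P.r (n + 1) k = P.r n j) := by
  have hj : k / 2 < 2 ^ n := by rw [pow_succ] at hk; omega
  refine ⟨k / 2, hj, ?_⟩
  rcases Nat.even_or_odd' k with ⟨j, rfl | rfl⟩
  · left
    have : 2 * j / 2 = j := by omega
    rw [this] at hj ⊢
    exact ⟨rfl, P.l_left n j hj, P.r_left n j hj⟩
  · right
    have : (2 * j + 1) / 2 = j := by omega
    rw [this] at hj ⊢
    exact ⟨rfl, P.l_right n j hj, P.r_right n j hj⟩

theorem subset_unit {n k : ℕ} (hk : k < 2 ^ n) : 0 ≤ P.l n k ∧ P.r n k ≤ 1 := by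
  induction n generalizing k with
  | zero =>
    obtain rfl : k = 0 := by simpa using hk
    exact ⟨P.l_root.ge, P.r_root.le⟩
  | succ n ih =>
    obtain ⟨j, hj, ⟨-, h1, h2⟩ | ⟨-, h1, h2⟩⟩ := P.exists_parent hk
    all_goals
      have := ih hj
      have := P.l_lt_m n j hj
      have := P.m_lt_r n j hj
      constructor <;> linarith

theorem l_mem {n k : ℕ} (hk : k < 2 ^ n) : P.l n k ∈ Icc (0 : ℝ) 1 :=
  ⟨(P.subset_unit hk).1, (P.l_lt_r hk).le.trans (P.subset_unit hk).2⟩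

theorem r_mem {n k : ℕ} (hk : k < 2 ^ n) : P.r n k ∈ Icc (0 : ℝ) 1 :=
  ⟨(P.subset_unit hk).1.trans (P.l_lt_r hk).le, (P.subset_unit hk).2⟩

theorem m_mem {n k : ℕ} (hk : k < 2 ^ n) : P.m n k ∈ Icc (0 : ℝ) 1 :=
  ⟨(P.subset_unit hk).1.trans (P.l_lt_m n k hk).le,
    (P.m_lt_r n k hk).le.trans (P.subset_unit hk).2⟩

/-- Distinct segments of the same generation do not overlap. -/
theorem disjoint_of_ne {n j k : ℕ} (hj : j < 2 ^ n) (hk : k < 2 ^ n) (hjk : j ≠ k) :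
    P.r n j ≤ P.l n k ∨ P.r n k ≤ P.l n j := by
  induction n generalizing j k with
  | zero => simp at hj hk; omega
  | succ n ih =>
    obtain ⟨j', hj', h1⟩ := P.exists_parent hj
    obtain ⟨k', hk', h2⟩ := P.exists_parent hk
    have := P.l_lt_m n j' hj'
    have := P.m_lt_r n j' hj'
    have := P.l_lt_m n k' hk'
    have := P.m_lt_r n k' hk'
    by_cases h : j' = k'
    · subst h
      rcases h1 with ⟨a1, b1, c1⟩ | ⟨a1, b1, c1⟩ <;>
      rcases h2 with ⟨a2, b2, c2⟩ | ⟨a2, b2, c2⟩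
      · omega
      · left; linarith
      · right; linarith
      · omega
    · rcases ih hj' hk' h with h3 | h3
      · left
        rcases h1 with ⟨a1, b1, c1⟩ | ⟨a1, b1, c1⟩ <;>
        rcases h2 with ⟨a2, b2, c2⟩ | ⟨a2, b2, c2⟩ <;> linarith
      · right
        rcases h1 with ⟨a1, b1, c1⟩ | ⟨a1, b1, c1⟩ <;>
        rcases h2 with ⟨a2, b2, c2⟩ | ⟨a2, b2, c2⟩ <;> linarith

/-- The points `l`, `m`, `r` of a segment do not lie inside the segments of later generations. -/
theorem separated_of_lt {n j : ℕ} (hj : j < 2 ^ n) {c : ℝ}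
    (hc : c = P.l n j ∨ c = P.m n j ∨ c = P.r n j) {n' k : ℕ} (hn : n < n') (hk : k < 2 ^ n') :
    c ≤ P.l n' k ∨ P.r n' k ≤ c := by
  have := P.l_lt_m n j hj
  have := P.m_lt_r n j hj
  induction n', hn using Nat.le_induction generalizing k with
  | base =>
    obtain ⟨k', hk', h2⟩ := P.exists_parent hk
    have := P.l_lt_m n k' hk'
    have := P.m_lt_r n k' hk'
    by_cases h : j = k'
    · subst h
      rcases hc with rfl | rfl | rfl <;> rcases h2 with ⟨-, b2, c2⟩ | ⟨-, b2, c2⟩ <;> grind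
    · rcases P.disjoint_of_ne hj hk' h with h3 | h3
      · left
        rcases hc with rfl | rfl | rfl <;> rcases h2 with ⟨-, b2, c2⟩ | ⟨-, b2, c2⟩ <;> linarith
      · right
        rcases hc with rfl | rfl | rfl <;> rcases h2 with ⟨-, b2, c2⟩ | ⟨-, b2, c2⟩ <;> linarith
  | succ n' hn ih =>
    obtain ⟨k', hk', h2⟩ := P.exists_parent hk
    have := P.l_lt_m n' k' hk'
    have := P.m_lt_r n' k' hk'
    rcases ih hk' with h3 | h3
    · left; rcases h2 with ⟨-, b2, c2⟩ | ⟨-, b2, c2⟩ <;> linarith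
    · right; rcases h2 with ⟨-, b2, c2⟩ | ⟨-, b2, c2⟩ <;> linarith

/-- This is what kills the coefficient of a segment on every other Schauder function of the same or
a later generation. -/
theorem separated {n j : ℕ} (hj : j < 2 ^ n) {c : ℝ}
    (hc : c = P.l n j ∨ c = P.m n j ∨ c = P.r n j) {n' k : ℕ} (hn : n ≤ n') (hk : k < 2 ^ n')
    (hne : n = n' → j ≠ k) :
    c ≤ P.l n' k ∨ P.r n' k ≤ c := by
  rcases hn.eq_or_lt with rfl | h
  · have := P.l_lt_m n j hj
    have := P.m_lt_r n j hj
    rcases P.disjoint_of_ne hj hk (hne rfl) with h3 | h3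
    · left; rcases hc with rfl | rfl | rfl <;> linarith
    · right; rcases hc with rfl | rfl | rfl <;> linarith
  · exact P.separated_of_lt hj hc h hk

/-- The segments of a generation cover the unit interval. -/
theorem exists_mem {t : ℝ} (ht : t ∈ Icc (0 : ℝ) 1) (n : ℕ) :
    ∃ k < 2 ^ n, P.l n k ≤ t ∧ t ≤ P.r n k := by
  induction n with
  | zero => exact ⟨0, by simp, P.l_root.trans_le ht.1, ht.2.trans P.r_root.ge⟩
  | succ n ih =>
    obtain ⟨k, hk, h1, h2⟩ := ih
    rcases le_total t (P.m n k) with h | h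
    · exact ⟨2 * k, by rw [pow_succ]; omega, by rwa [P.l_left n k hk], by rwa [P.r_left n k hk]⟩
    · exact ⟨2 * k + 1, by rw [pow_succ]; omega, by rwa [P.l_right n k hk],
        by rwa [P.r_right n k hk]⟩

theorem exists_length_le : ∃ ρ : ℝ, 0 < ρ ∧ ρ < 1 ∧ ∀ n k, k < 2 ^ n →
    P.r n k - P.l n k ≤ ρ ^ n := by
  obtain ⟨ρ, h0, h1, h⟩ := P.contraction
  refine ⟨ρ, h0, h1, fun n => ?_⟩
  induction n with
  | zero =>
    intro k hk
    obtain rfl : k = 0 := by simpa using hk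
    simp [P.l_root, P.r_root]
  | succ n ih =>
    intro k hk
    obtain ⟨j, hj, h2⟩ := P.exists_parent hk
    have h3 := h n j hj
    have h4 : ρ * (P.r n j - P.l n j) ≤ ρ * ρ ^ n := mul_le_mul_of_nonneg_left (ih j hj) h0.le
    rw [pow_succ']
    rcases h2 with ⟨-, a, b⟩ | ⟨-, a, b⟩
    · linarith [le_max_right (P.r n j - P.m n j) (P.m n j - P.l n j)]
    · linarith [le_max_left (P.r n j - P.m n j) (P.m n j - P.l n j)]

/-- A function which is continuous on `[0,1]` vanishes there if it vanishes at the left end points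
of all segments. -/
theorem eq_zero_of_left_endpoints {F : ℝ → ℝ} (hF : ContinuousOn F (Icc 0 1))
    (h : ∀ n k, k < 2 ^ n → F (P.l n k) = 0) {t : ℝ} (ht : t ∈ Icc (0 : ℝ) 1) : F t = 0 := by
  obtain ⟨ρ, h0, h1, hρ⟩ := P.exists_length_le
  -- One segment around t per generation; its left end point is within ρⁿ of t.
  choose k hk h2 h3 using fun n => P.exists_mem ht n
  have hlim : Tendsto (fun n => P.l n (k n)) atTop (𝓝 t) := by
    have hp := tendsto_pow_atTop_nhds_zero_of_lt_one h0.le h1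
    refine tendsto_of_tendsto_of_tendsto_of_le_of_le (g := fun n => t - ρ ^ n) (h := fun _ => t)
      (by simpa using hp.const_sub t) tendsto_const_nhds (fun n => ?_) (fun n => h2 n)
    have := hρ n (k n) (hk n)
    have := h3 n
    simp only
    linarith
  have hlim' : Tendsto (fun n => P.l n (k n)) atTop (𝓝[Icc 0 1] t) :=
    tendsto_nhdsWithin_iff.2 ⟨hlim, Eventually.of_forall fun n => P.l_mem (hk n)⟩
  have := (hF t ht).tendsto.comp hlim'
  refine tendsto_nhds_unique this ?_
  have : (F ∘ fun n => P.l n (k n)) = fun _ => 0 := funext fun n => h n (k n) (hk n)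
  rw [this]
  exact tendsto_const_nhds

end NestedPartition

/-! ### Integration on the unit interval -/

section UnitInterval

variable {q z : ℝ → ℝ}

theorem exists_bound_of_continuousOn (hq : ContinuousOn q (Icc 0 1)) :
    ∃ C, 0 ≤ C ∧ ∀ t ∈ Icc (0 : ℝ) 1, |q t| ≤ C := by
  obtain ⟨C, hC⟩ := isCompact_Icc.exists_bound_of_continuousOn hq
  exact ⟨C, (norm_nonneg _).trans (hC 0 (by simp)), hC⟩

theorem memLp_of_continuousOn (hq : ContinuousOn q (Icc 0 1)) : MemLp q 2 μ₀ := by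
  obtain ⟨C, -, hC⟩ := exists_bound_of_continuousOn hq
  exact MemLp.of_bound (hq.aestronglyMeasurable measurableSet_Icc) C
    ((ae_restrict_iff' measurableSet_Icc).2 (Eventually.of_forall hC))

theorem intervalIntegrable_of_integrable (hz : Integrable z μ₀) {a b : ℝ}
    (ha : a ∈ Icc (0 : ℝ) 1) (hb : b ∈ Icc (0 : ℝ) 1) : IntervalIntegrable z volume a b := by
  have h : IntegrableOn z (Icc 0 1) := hz
  exact (h.mono_set (uIcc_subset_Icc ha hb)).intervalIntegrable

theorem integrable_continuousOn_mul (hq : ContinuousOn q (Icc 0 1)) (hz : Integrable z μ₀) :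
    Integrable (fun t => q t * z t) μ₀ :=
  IntegrableOn.continuousOn_mul hq hz isCompact_Icc

theorem integrable_of_continuousOn (hq : ContinuousOn q (Icc 0 1)) : Integrable q μ₀ :=
  hq.integrableOn_Icc

theorem integrable_coe (x : L2Unit) : Integrable x μ₀ :=
  (Lp.memLp x).integrable one_le_two

theorem continuousOn_primitive_of_integrable (hz : Integrable z μ₀) :
    ContinuousOn (fun t => ∫ s in (0 : ℝ)..t, z s) (Icc 0 1) := by
  have h : IntegrableOn z (uIcc 0 1) := by rwa [uIcc_of_le zero_le_one]
  simpa [uIcc_of_le (zero_le_one (α := ℝ))] using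
    intervalIntegral.continuousOn_primitive_interval h

theorem integral_unit_eq : ∫ t, z t ∂μ₀ = ∫ t in (0 : ℝ)..1, z t := by
  rw [intervalIntegral.integral_of_le zero_le_one, integral_Icc_eq_integral_Ioc]

theorem integral_sub_integral (hz : Integrable z μ₀) {a b : ℝ} (ha : a ∈ Icc (0 : ℝ) 1)
    (hb : b ∈ Icc (0 : ℝ) 1) :
    (∫ s in (0 : ℝ)..b, z s) - ∫ s in (0 : ℝ)..a, z s = ∫ s in a..b, z s := by
  rw [intervalIntegral.integral_interval_sub_left] <;>
  exact intervalIntegrable_of_integrable hz (by simp) (by assumption)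

theorem integral_indicator_Ico {a b : ℝ} (ha : 0 ≤ a) (hab : a ≤ b)
    (hb : b ≤ 1) : ∫ t, (Ico a b).indicator z t ∂μ₀ = ∫ t in a..b, z t := by
  rw [integral_indicator measurableSet_Ico, Measure.restrict_restrict measurableSet_Ico,
    inter_eq_left.2, intervalIntegral.integral_of_le hab, integral_Ico_eq_integral_Ioo,
    integral_Ioc_eq_integral_Ioo]
  exact fun t ht => ⟨ha.trans ht.1, ht.2.le.trans hb⟩

theorem integral_indicator_Iic {t : ℝ} (h0 : 0 ≤ t) (h1 : t ≤ 1) :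
    ∫ s, (Iic t).indicator z s ∂μ₀ = ∫ s in (0 : ℝ)..t, z s := by
  rw [integral_indicator measurableSet_Iic, Measure.restrict_restrict measurableSet_Iic,
    intervalIntegral.integral_of_le h0, ← integral_Icc_eq_integral_Ioc]
  congr 2
  ext s; simp only [mem_inter_iff, mem_Iic, mem_Icc]; grind

theorem intervalIntegral_indicator_Iic {t s : ℝ} (h0 : 0 ≤ t) (hs : 0 ≤ s) :
    ∫ u in (0 : ℝ)..s, (Iic t).indicator z u = ∫ u in (0 : ℝ)..(min s t), z u := by
  rw [intervalIntegral.integral_of_le hs, intervalIntegral.integral_of_le (le_min hs h0),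
    integral_indicator measurableSet_Iic, Measure.restrict_restrict measurableSet_Iic]
  congr 2
  ext u; simp only [mem_inter_iff, mem_Iic, mem_Ioc, le_min_iff]; grind

/-- Used to exchange the chosen representative of an L² class for an explicit function inside a
primitive. -/
theorem intervalIntegral_congr_of_ae {z' : ℝ → ℝ} (h : z =ᵐ[μ₀] z') (q : ℝ → ℝ) {a b : ℝ}
    (ha : a ∈ Icc (0 : ℝ) 1) (hb : b ∈ Icc (0 : ℝ) 1) :
    ∫ s in a..b, q s * z s = ∫ s in a..b, q s * z' s := by
  refine intervalIntegral.integral_congr_ae ?_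
  have := (ae_restrict_iff' measurableSet_Icc).1 h
  filter_upwards [this] with s hs hsab
  rw [hs]
  have := uIoc_subset_uIcc hsab
  exact uIcc_subset_Icc ha hb this

theorem inner_toLp {u : ℝ → ℝ} (hu : MemLp u 2 μ₀) (x : L2Unit) :
    inner ℝ (hu.toLp u) x = ∫ t, u t * x t ∂μ₀ := by
  rw [L2.inner_def]
  refine integral_congr_ae ?_
  filter_upwards [hu.coeFn_toLp] with t ht
  rw [ht]
  simp [mul_comm]

theorem coeFn_sum_smul_toLp {ι : Type} (F : Finset ι) (c : ι → ℝ) {u : ι → ℝ → ℝ}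
    (hu : ∀ i, MemLp (u i) 2 μ₀) :
    ⇑(∑ i ∈ F, c i • (hu i).toLp (u i)) =ᵐ[μ₀] fun t => ∑ i ∈ F, c i * u i t := by
  classical
  induction F using Finset.induction_on with
  | empty =>
    filter_upwards [Lp.coeFn_zero ℝ 2 μ₀] with t ht
    simpa using ht
  | insert i F hi ih =>
    rw [Finset.sum_insert hi]
    filter_upwards [Lp.coeFn_add (c i • (hu i).toLp (u i)) (∑ i ∈ F, c i • (hu i).toLp (u i)),
      Lp.coeFn_smul (c i) ((hu i).toLp (u i)), (hu i).coeFn_toLp, ih] with t h1 h2 h3 h4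
    rw [h1, Pi.add_apply, h2, h4, Finset.sum_insert hi, Pi.smul_apply, h3, smul_eq_mul]

/-- An integrable function with vanishing primitive vanishes. -/
theorem ae_eq_zero_of_primitive_eq_zero (hz : Integrable z μ₀)
    (h : ∀ t ∈ Icc (0 : ℝ) 1, ∫ s in (0 : ℝ)..t, z s = 0) : z =ᵐ[μ₀] 0 := by
  have hi : IntervalIntegrable z volume 0 1 := intervalIntegrable_of_integrable hz (by simp) (by simp)
  -- The end points are discarded so that [0,1] is a neighbourhood of x and the two derivatives
  -- there can be compared.
  have h0 : ∀ᵐ x : ℝ, x ≠ 0 := by simp [ae_iff, measure_singleton]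
  have h1 : ∀ᵐ x : ℝ, x ≠ 1 := by simp [ae_iff, measure_singleton]
  refine (ae_restrict_iff' measurableSet_Icc).2 ?_
  filter_upwards [hi.ae_hasDerivAt_integral, h0, h1] with x hx hx0 hx1 hxm
  have hd := hx (by rwa [uIcc_of_le zero_le_one]) 0 (by simp)
  refine hd.unique ?_
  have : Icc (0 : ℝ) 1 ∈ 𝓝 x :=
    Icc_mem_nhds (lt_of_le_of_ne hxm.1 hx0.symm) (lt_of_le_of_ne hxm.2 hx1)
  refine (hasDerivAt_const x (0 : ℝ)).congr_of_eventuallyEq ?_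
  filter_upwards [this] with t ht using h t ht

end UnitInterval

/-! ### The constants L, R, M of a segment -/

/-- The hypotheses on the drift `a` and the squared noise intensity `Γ` on which the construction
of the bases depends. -/
structure Regular (Γ a : ℝ → ℝ) : Prop where
  drift : ContinuousOn a (Icc 0 1)
  sqrt : ContinuousOn (fun t => √(Γ t)) (Icc 0 1)
  pos : ∀ t ∈ Icc (0 : ℝ) 1, 0 < Γ t

theorem g_pos (a : ℝ → ℝ) (t : ℝ) : 0 < g a t := Real.exp_pos _

namespace Regular

variable {Γ a : ℝ → ℝ} (H : Regular Γ a)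
include H

theorem continuousOn_primitive : ContinuousOn (fun t => ∫ v in (0 : ℝ)..t, a v) (Icc 0 1) :=
  continuousOn_primitive_of_integrable (integrable_of_continuousOn H.drift)

theorem continuousOn_g : ContinuousOn (g a) (Icc 0 1) :=
  Real.continuous_exp.comp_continuousOn H.continuousOn_primitive

theorem continuousOn_f : ContinuousOn (f Γ a) (Icc 0 1) :=
  H.sqrt.mul (Real.continuous_exp.comp_continuousOn H.continuousOn_primitive.neg)

theorem f_pos {t : ℝ} (ht : t ∈ Icc (0 : ℝ) 1) : 0 < f Γ a t :=
  mul_pos (Real.sqrt_pos.2 (H.pos t ht)) (Real.exp_pos _)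

theorem integrable_f_sq : Integrable (fun t => f Γ a t ^ 2) μ₀ :=
  integrable_of_continuousOn (H.continuousOn_f.pow 2)

theorem h_sub_h {s t : ℝ} (hs : s ∈ Icc (0 : ℝ) 1) (ht : t ∈ Icc (0 : ℝ) 1) :
    h Γ a t - h Γ a s = hInc Γ a s t :=
  integral_sub_integral H.integrable_f_sq hs ht

theorem hInc_pos {s t : ℝ} (hs : 0 ≤ s) (hst : s < t) (ht : t ≤ 1) : 0 < hInc Γ a s t := by
  refine intervalIntegral.intervalIntegral_pos_of_pos_on
    (intervalIntegrable_of_integrable H.integrable_f_sq ⟨hs, by linarith⟩ ⟨by linarith, ht⟩)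
    (fun u hu => ?_) hst
  exact pow_pos (H.f_pos ⟨by linarith [hu.1], by linarith [hu.2]⟩) 2

theorem h_one_pos : 0 < h Γ a 1 := H.hInc_pos le_rfl one_pos le_rfl

theorem coefL0_sq_mul : coefL0 Γ a * (h Γ a 1 * coefL0 Γ a) = 1 := by
  have h1 := H.h_one_pos
  have h2 := g_pos a 1
  have h3 := Real.sq_sqrt h1.le
  unfold coefL0
  field_simp
  exact h3

theorem coefL0_ne_zero : coefL0 Γ a ≠ 0 := by
  intro h0
  simpa [h0] using H.coefL0_sq_mul

variable {l m r : ℝ} (hl : 0 ≤ l) (hlm : l < m) (hmr : m < r) (hr : r ≤ 1)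
include hl hlm hmr hr

theorem sigma_pos : 0 < sigma Γ a l m r :=
  mul_pos (g_pos a m) (Real.sqrt_pos.2 (div_pos (mul_pos (H.hInc_pos hl hlm (by linarith))
    (H.hInc_pos (by linarith) hmr hr)) (H.hInc_pos hl (by linarith) hr)))

theorem hInc_add : hInc Γ a l m + hInc Γ a m r = hInc Γ a l r := by
  rw [← H.h_sub_h, ← H.h_sub_h, ← H.h_sub_h]
  · ring
  all_goals constructor <;> linarith

theorem coefL_pos : 0 < coefL Γ a l m r :=
  div_pos (H.sigma_pos hl hlm hmr hr) (mul_pos (g_pos a m) (H.hInc_pos hl hlm (by linarith)))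

theorem coefR_pos : 0 < coefR Γ a l m r :=
  div_pos (H.sigma_pos hl hlm hmr hr) (mul_pos (g_pos a m) (H.hInc_pos (by linarith) hmr hr))

theorem coefL_mul : coefL Γ a l m r * hInc Γ a l m = sigma Γ a l m r / g a m := by
  have := (H.hInc_pos hl hlm (by linarith)).ne'
  have := (g_pos a m).ne'
  unfold coefL
  field_simp

theorem coefR_mul : coefR Γ a l m r * hInc Γ a m r = sigma Γ a l m r / g a m := by
  have := (H.hInc_pos (by linarith) hmr hr).ne'
  have := (g_pos a m).ne'
  unfold coefR
  field_simp

theorem coefM_mul : coefM Γ a l m r * (sigma Γ a l m r / g a m) = 1 := by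
  have := (g_pos a m).ne'
  have := (H.sigma_pos hl hlm hmr hr).ne'
  unfold coefM
  field_simp

/-- Since σ² = g(m)² h(l,m) h(m,r) / h(l,r) and h is additive, this is 1/h(l,m) + 1/h(m,r) = h(l,r)
/ (h(l,m) h(m,r)) multiplied by σ/g(m). It means that δ annihilates multiples of g, hence sees only
increments of x/g. -/
theorem coefM_eq : coefM Γ a l m r = coefL Γ a l m r + coefR Γ a l m r := by
  have h1 := H.hInc_pos hl hlm (by linarith)
  have h2 := H.hInc_pos (by linarith) hmr hr
  have h3 := H.hInc_pos hl (by linarith) hr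
  have h4 := g_pos a m
  have h5 := H.sigma_pos hl hlm hmr hr
  have h6 : sigma Γ a l m r ^ 2
      = g a m ^ 2 * (hInc Γ a l m * hInc Γ a m r / hInc Γ a l r) := by
    rw [sigma, mul_pow, Real.sq_sqrt (by positivity)]
  have h7 := H.hInc_add hl hlm hmr hr
  unfold coefM coefL coefR
  rw [← h7] at h6
  field_simp at h6 ⊢
  linarith

end Regular

/-! ### Duality of the coefficients δ with the functions ψ and φ -/

theorem coefficient_g_mul_none (P : NestedPartition) (Γ a : ℝ → ℝ) (F : ℝ → ℝ) :
    coefficient P Γ a (fun t => g a t * F t) none = coefL0 Γ a * F 1 := by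
  simp only [coefficient]
  rw [inv_mul_cancel_left₀ (g_pos a 1).ne']

theorem phi_eq_indicator (P : NestedPartition) (Γ a : ℝ → ℝ) (n : ℕ) (k : Fin (2 ^ n)) :
    phi P Γ a (some ⟨n, k⟩) = fun t =>
      coefL Γ a (P.l n k) (P.m n k) (P.r n k) * (Ico (P.l n k) (P.m n k)).indicator (f Γ a) t
      - coefR Γ a (P.l n k) (P.m n k) (P.r n k) *
        (Ico (P.m n k) (P.r n k)).indicator (f Γ a) t := by
  ext t
  simp only [phi, indicator, mem_Ico]
  have := P.l_lt_m n k k.2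
  have := P.m_lt_r n k k.2
  split_ifs <;> grind

theorem psi_some_eq_zero (P : NestedPartition) (Γ a : ℝ → ℝ) {n : ℕ} {k : Fin (2 ^ n)} {t : ℝ} (ht : t ≤ P.l n k ∨ P.r n k ≤ t) :
    psi P Γ a (some ⟨n, k⟩) t = 0 := by
  have hl := P.l_lt_m n k k.2
  have hr := P.m_lt_r n k k.2
  simp only [psi]
  rcases ht with ht | ht
  · rcases ht.eq_or_lt with rfl | ht
    · rw [if_pos ⟨le_rfl, hl.le⟩]; simp [hInc]
    · rw [if_neg (by grind), if_neg (by grind)]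
  · rcases ht.eq_or_lt with rfl | ht
    · rw [if_neg (by grind), if_pos ⟨hr.le, le_rfl⟩]; simp [hInc]
    · rw [if_neg (by grind), if_neg (by grind)]

theorem coefficient_congr (P : NestedPartition) (Γ a : ℝ → ℝ) {F F' : ℝ → ℝ} (h : ∀ t ∈ Icc (0 : ℝ) 1, F t = F' t) (i : Idx) :
    coefficient P Γ a F i = coefficient P Γ a F' i := by
  match i with
  | none => simp only [coefficient, h 1 (by simp)]
  | some ⟨n, k⟩ =>
    simp only [coefficient, h _ (P.l_mem k.2), h _ (P.m_mem k.2), h _ (P.r_mem k.2)]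

/-- The three points charged by δ lie outside the open support of ψ. Only this half of
biorthogonality is needed, as the symmetry of the inner product will supply the other. -/
theorem coefficient_psi_of_le (P : NestedPartition) (Γ a : ℝ → ℝ) {n n' : ℕ} {j : Fin (2 ^ n)} {k : Fin (2 ^ n')} (hn : n ≤ n')
    (hne : n = n' → (j : ℕ) ≠ k) :
    coefficient P Γ a (psi P Γ a (some ⟨n', k⟩)) (some ⟨n, j⟩) = 0 := by
  simp only [coefficient]
  rw [psi_some_eq_zero P Γ a (P.separated j.2 (.inl rfl) hn k.2 hne),
    psi_some_eq_zero P Γ a (P.separated j.2 (.inr (.inl rfl)) hn k.2 hne),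
    psi_some_eq_zero P Γ a (P.separated j.2 (.inr (.inr rfl)) hn k.2 hne)]
  simp

theorem coefficient_psi_none (P : NestedPartition) (Γ a : ℝ → ℝ) (n : ℕ) (k : Fin (2 ^ n)) :
    coefficient P Γ a (psi P Γ a (some ⟨n, k⟩)) none = 0 := by
  simp only [coefficient]
  rw [psi_some_eq_zero P Γ a (.inr (P.subset_unit k.2).2)]
  simp

namespace Regular

variable {Γ a : ℝ → ℝ} (H : Regular Γ a) (P : NestedPartition)
include H

theorem coefficient_g_mul_some (F : ℝ → ℝ) (n : ℕ) (k : Fin (2 ^ n)) :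
    coefficient P Γ a (fun t => g a t * F t) (some ⟨n, k⟩) =
      coefL Γ a (P.l n k) (P.m n k) (P.r n k) * (F (P.m n k) - F (P.l n k))
      - coefR Γ a (P.l n k) (P.m n k) (P.r n k) * (F (P.r n k) - F (P.m n k)) := by
  simp only [coefficient]
  rw [inv_mul_cancel_left₀ (g_pos a _).ne', inv_mul_cancel_left₀ (g_pos a _).ne',
    inv_mul_cancel_left₀ (g_pos a _).ne', H.coefM_eq (P.subset_unit k.2).1 (P.l_lt_m n k k.2)
    (P.m_lt_r n k k.2) (P.subset_unit k.2).2]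
  ring

theorem memLp_phi (i : Idx) : MemLp (phi P Γ a i) 2 μ₀ := by
  have hf := memLp_of_continuousOn H.continuousOn_f
  match i with
  | none => exact hf.mul_const _
  | some ⟨n, k⟩ =>
    rw [phi_eq_indicator]
    exact ((hf.indicator measurableSet_Ico).const_mul _).sub
      ((hf.indicator measurableSet_Ico).const_mul _)

/-- Pairing with `φ` is the coefficient application on primitives. -/
theorem integral_phi_mul {z : ℝ → ℝ} (hz : Integrable (fun t => f Γ a t * z t) μ₀) (i : Idx) :
    ∫ t, phi P Γ a i t * z t ∂μ₀ =
      coefficient P Γ a (fun t => g a t * ∫ s in (0 : ℝ)..t, f Γ a s * z s) i := by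
  match i with
  | none =>
    rw [coefficient_g_mul_none, ← integral_unit_eq, ← integral_const_mul]
    exact integral_congr_ae (Eventually.of_forall fun t => by simp only [phi]; ring)
  | some ⟨n, k⟩ =>
    have h1 := P.subset_unit k.2
    have h2 := P.l_lt_m n k k.2
    have h3 := P.m_lt_r n k k.2
    rw [H.coefficient_g_mul_some, integral_sub_integral hz (P.l_mem k.2) (P.m_mem k.2),
      integral_sub_integral hz (P.m_mem k.2) (P.r_mem k.2),
      ← integral_indicator_Ico h1.1 h2.le (by linarith),
      ← integral_indicator_Ico (by linarith) h3.le (by linarith), phi_eq_indicator,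
      ← integral_const_mul, ← integral_const_mul, ← integral_sub]
    · refine integral_congr_ae (Eventually.of_forall fun t => ?_)
      simp only [indicator]
      split_ifs <;> ring
    · exact (hz.indicator measurableSet_Ico).const_mul _
    · exact (hz.indicator measurableSet_Ico).const_mul _

/-- The Schauder functions are the weighted primitives of the functions `φ`. -/
theorem psi_eq (i : Idx) {t : ℝ} (ht : t ∈ Icc (0 : ℝ) 1) :
    psi P Γ a i t = g a t * ∫ s in (0 : ℝ)..t, f Γ a s * phi P Γ a i s := by
  have hint : Integrable (fun s => f Γ a s * (Iic t).indicator (f Γ a) s) μ₀ :=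
    integrable_continuousOn_mul H.continuousOn_f
      ((integrable_of_continuousOn H.continuousOn_f).indicator measurableSet_Iic)
  -- The primitive of f φ_i at t is the pairing of φ_i with f 1_[0,t], hence the coefficient of the
  -- path s ↦ g(s) h(s ∧ t). The rest is a case check on the position of t.
  have h1 : ∫ s in (0 : ℝ)..t, f Γ a s * phi P Γ a i s
      = coefficient P Γ a (fun s => g a s * ∫ u in (0 : ℝ)..s, f Γ a u *
        (Iic t).indicator (f Γ a) u) i := by
    rw [← H.integral_phi_mul P hint, ← integral_indicator_Iic ht.1 ht.2]
    refine integral_congr_ae (Eventually.of_forall fun s => ?_)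
    simp only [indicator]
    split_ifs <;> ring
  have h2 : ∀ s, 0 ≤ s → ∫ u in (0 : ℝ)..s, f Γ a u * (Iic t).indicator (f Γ a) u
      = h Γ a (min s t) := by
    intro s hs
    rw [h, hInc, ← intervalIntegral_indicator_Iic ht.1 hs]
    refine intervalIntegral.integral_congr fun u _ => ?_
    simp only [indicator]
    split_ifs <;> ring
  rw [h1]
  match i with
  | none =>
    rw [coefficient_g_mul_none, h2 1 zero_le_one, min_eq_right ht.2]
    simp only [psi, h]
    ring
  | some ⟨n, k⟩ =>
    have hs := P.subset_unit k.2
    have hl := P.l_lt_m n k k.2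
    have hr := P.m_lt_r n k k.2
    rw [H.coefficient_g_mul_some, h2 _ (P.l_mem k.2).1, h2 _ (P.m_mem k.2).1,
      h2 _ (P.r_mem k.2).1]
    have hL := H.coefL_mul hs.1 hl hr hs.2
    have hR := H.coefR_mul hs.1 hl hr hs.2
    rw [← H.h_sub_h (P.l_mem k.2) (P.m_mem k.2)] at hL
    rw [← H.h_sub_h (P.m_mem k.2) (P.r_mem k.2)] at hR
    simp only [psi]
    rcases lt_or_ge t (P.l n k) with c1 | c1
    · rw [if_neg (by grind), if_neg (by grind), min_eq_right, min_eq_right, min_eq_right] <;>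
      grind
    rcases le_or_gt t (P.m n k) with c2 | c2
    · rw [if_pos ⟨c1, c2⟩, min_eq_left c1, min_eq_right c2, min_eq_right (c2.trans hr.le),
        ← H.h_sub_h (P.l_mem k.2) ht]
      ring
    rcases le_or_gt t (P.r n k) with c3 | c3
    · rw [if_neg (by grind), if_pos ⟨c2.le, c3⟩, min_eq_left c1, min_eq_left c2.le,
        min_eq_right c3, ← H.h_sub_h ht (P.r_mem k.2)]
      -- Both L h(l,m) and R h(m,r) equal σ/g(m): the two branches of ψ meet at m and the total mass
      -- of f φ is zero.
      linear_combination g a t * (hR - hL)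
    · rw [if_neg (by grind), if_neg (by grind), min_eq_left c1, min_eq_left c2.le,
        min_eq_left c3.le]
      linear_combination g a t * (hR - hL)

/-! ### The Hilbert basis φ and the uniform convergence of Ψ -/

/-- The functions `φ`, as elements of `L²[0,1]`. -/
noncomputable def phiLp (i : Idx) : L2Unit := (H.memLp_phi P i).toLp _

theorem coeFn_phiLp (i : Idx) : H.phiLp P i =ᵐ[μ₀] phi P Γ a i :=
  (H.memLp_phi P i).coeFn_toLp

theorem inner_phiLp (i : Idx) (x : L2Unit) : inner ℝ (H.phiLp P i) x =
    coefficient P Γ a (fun t => g a t * ∫ s in (0 : ℝ)..t, f Γ a s * x s) i := by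
  rw [phiLp, inner_toLp, H.integral_phi_mul]
  exact integrable_continuousOn_mul H.continuousOn_f (integrable_coe x)

/-- The biorthogonality of `φ` is that of `δ` and `ψ`. -/
theorem inner_phiLp_phiLp (i j : Idx) :
    inner ℝ (H.phiLp P i) (H.phiLp P j) = coefficient P Γ a (psi P Γ a j) i := by
  rw [H.inner_phiLp]
  refine coefficient_congr P Γ a (fun t ht => ?_) i
  rw [H.psi_eq P j ht, intervalIntegral_congr_of_ae (H.coeFn_phiLp P j) _ (by simp) ht]

theorem coefficient_psi_self (i : Idx) : coefficient P Γ a (psi P Γ a i) i = 1 := by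
  match i with
  | none =>
    simp only [coefficient, psi]
    rw [mul_assoc (g a 1), inv_mul_cancel_left₀ (g_pos a 1).ne']
    exact H.coefL0_sq_mul
  | some ⟨n, k⟩ =>
    have hs := P.subset_unit k.2
    have hl := P.l_lt_m n k k.2
    have hr := P.m_lt_r n k k.2
    simp only [coefficient]
    rw [psi_some_eq_zero P Γ a (Or.inl le_rfl), psi_some_eq_zero P Γ a (Or.inr le_rfl)]
    simp only [psi, if_pos (And.intro hl.le le_rfl)]
    rw [mul_assoc (g a _), inv_mul_cancel_left₀ (g_pos a _).ne', mul_comm (hInc _ _ _ _),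
      H.coefL_mul hs.1 hl hr hs.2, H.coefM_mul hs.1 hl hr hs.2]
    simp

/-- By symmetry the index of the earlier generation can be put on the side of δ, where the
separation of supports applies. -/
theorem orthonormal_phiLp : Orthonormal ℝ (H.phiLp P) := by
  classical
  rw [orthonormal_iff_ite]
  intro i j
  split_ifs with hij
  · rw [← hij, H.inner_phiLp_phiLp, H.coefficient_psi_self]
  match i, j with
  | none, none => simp at hij
  | none, some ⟨n, k⟩ => rw [H.inner_phiLp_phiLp, coefficient_psi_none]
  | some ⟨n, k⟩, none => rw [real_inner_comm, H.inner_phiLp_phiLp, coefficient_psi_none]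
  | some ⟨n, k⟩, some ⟨n', k'⟩ =>
    have hne : n = n' → (k : ℕ) ≠ k' := by
      rintro rfl hk
      exact hij (by rw [Fin.ext hk])
    rcases le_total n n' with h | h
    · rw [H.inner_phiLp_phiLp, coefficient_psi_of_le P Γ a h hne]
    · rw [real_inner_comm, H.inner_phiLp_phiLp,
        coefficient_psi_of_le P Γ a h fun h1 h2 => hne h1.symm h2.symm]

/-- Let F be the primitive of f x. The index (0,0) gives F(1) = 0; if F vanishes at l and r, the
index of that segment gives (L + R) F(m) = 0. So F vanishes at all division points, by density
everywhere, and f x = 0 almost everywhere with f > 0. -/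
theorem eq_zero_of_inner_phiLp {x : L2Unit} (hx : ∀ i, inner ℝ (H.phiLp P i) x = 0) : x = 0 := by
  have hint := integrable_continuousOn_mul H.continuousOn_f (integrable_coe x)
  set F : ℝ → ℝ := fun t => ∫ s in (0 : ℝ)..t, f Γ a s * x s with hF
  have h0 : F 0 = 0 := by simp [hF]
  have h1 : F 1 = 0 := by
    have := hx none
    rw [H.inner_phiLp, coefficient_g_mul_none] at this
    exact (mul_eq_zero.1 this).resolve_left H.coefL0_ne_zero
  have key : ∀ n k, k < 2 ^ n → F (P.l n k) = 0 → F (P.r n k) = 0 → F (P.m n k) = 0 := by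
    intro n k hk hl hr
    have hs := P.subset_unit hk
    have := hx (some ⟨n, k, hk⟩)
    rw [H.inner_phiLp, H.coefficient_g_mul_some] at this
    have hL := H.coefL_pos hs.1 (P.l_lt_m n k hk) (P.m_lt_r n k hk) hs.2
    have hR := H.coefR_pos hs.1 (P.l_lt_m n k hk) (P.m_lt_r n k hk) hs.2
    change _ * (F (P.m n k) - F (P.l n k)) - _ * (F (P.r n k) - F (P.m n k)) = 0 at this
    rw [hl, hr] at this
    have h2 : (coefL Γ a (P.l n k) (P.m n k) (P.r n k) + coefR Γ a (P.l n k) (P.m n k) (P.r n k))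
      * F (P.m n k) = 0 := by linarith
    exact (mul_eq_zero.1 h2).resolve_left (by positivity)
  have hend : ∀ n k, k < 2 ^ n → F (P.l n k) = 0 ∧ F (P.r n k) = 0 := by
    intro n
    induction n with
    | zero =>
      intro k hk
      obtain rfl : k = 0 := by simpa using hk
      rw [P.l_root, P.r_root]
      exact ⟨h0, h1⟩
    | succ n ih =>
      intro k hk
      obtain ⟨j, hj, ⟨-, a, b⟩ | ⟨-, a, b⟩⟩ := P.exists_parent hk
      · rw [a, b]; exact ⟨(ih j hj).1, key n j hj (ih j hj).1 (ih j hj).2⟩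
      · rw [a, b]; exact ⟨key n j hj (ih j hj).1 (ih j hj).2, (ih j hj).2⟩
  have hzero : (fun t => f Γ a t * x t) =ᵐ[μ₀] 0 :=
    ae_eq_zero_of_primitive_eq_zero hint fun t ht =>
      P.eq_zero_of_left_endpoints (continuousOn_primitive_of_integrable hint)
        (fun n k hk => (hend n k hk).1) ht
  refine (Lp.eq_zero_iff_ae_eq_zero).2 ?_
  filter_upwards [hzero, ae_restrict_mem measurableSet_Icc] with t ht htm
  exact (mul_eq_zero.1 ht).resolve_left (H.f_pos htm).ne'

/-- The functions `φ` form a Hilbert basis of `L²[0,1]`. -/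
noncomputable def basis : HilbertBasis Idx ℝ L2Unit :=
  HilbertBasis.mkOfOrthogonalEqBot (H.orthonormal_phiLp P) <| by
    rw [Submodule.eq_bot_iff]
    intro x hx
    refine H.eq_zero_of_inner_phiLp P fun i => ?_
    exact (Submodule.mem_orthogonal _ _).1 hx _ (Submodule.subset_span ⟨i, rfl⟩)

theorem basis_apply (i : Idx) : H.basis P i = H.phiLp P i := by
  rw [basis, HilbertBasis.coe_mkOfOrthogonalEqBot]

theorem hasSum_basis (ξ : L2Seq) :
    HasSum (fun i => ξ i • H.phiLp P i) ((H.basis P).repr.symm ξ) := by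
  simpa only [H.basis_apply] using (H.basis P).hasSum_repr_symm ξ

theorem tendsto_eLpNorm (ξ : L2Seq) : Tendsto (fun F : Finset Idx => eLpNorm
    (fun t => (H.basis P).repr.symm ξ t - ∑ i ∈ F, phi P Γ a i t * ξ i) 2 μ₀) atTop (𝓝 0) := by
  have h : Tendsto (fun F : Finset Idx => ∑ i ∈ F, ξ i • H.phiLp P i) atTop
    (𝓝 ((H.basis P).repr.symm ξ)) := H.hasSum_basis P ξ
  have h2 := tendsto_iff_edist_tendsto_0.1 h
  refine h2.congr fun F => ?_
  rw [edist_comm, Lp.edist_def]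
  refine eLpNorm_congr_ae ?_
  filter_upwards [coeFn_sum_smul_toLp F ξ (H.memLp_phi P)] with t ht
  simp only [Pi.sub_apply, phiLp, ht, mul_comm]

/-- The function `f 1_[0,t]` as an element of `L²[0,1]`. -/
noncomputable def cutoffLp (t : ℝ) : L2Unit :=
  MemLp.toLp ((Iic t).indicator (f Γ a))
    ((memLp_of_continuousOn H.continuousOn_f).indicator measurableSet_Iic)

theorem inner_cutoffLp {t : ℝ} (ht : t ∈ Icc (0 : ℝ) 1) (x : L2Unit) :
    inner ℝ (H.cutoffLp t) x = ∫ s in (0 : ℝ)..t, f Γ a s * x s := by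
  rw [cutoffLp, inner_toLp, ← integral_indicator_Iic ht.1 ht.2]
  refine integral_congr_ae (Eventually.of_forall fun s => ?_)
  simp only [indicator]
  split_ifs <;> ring

/-- The bound does not depend on t; this turns L² convergence of ∑ ξ_i φ_i into uniform convergence
of ∑ ξ_i ψ_i. -/
theorem norm_cutoffLp_le (t : ℝ) :
    ‖H.cutoffLp t‖ ≤ ‖(memLp_of_continuousOn H.continuousOn_f).toLp (f Γ a)‖ := by
  refine Lp.norm_le_norm_of_ae_le ?_
  have hu := (memLp_of_continuousOn H.continuousOn_f).indicator (measurableSet_Iic (a := t))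
  filter_upwards [(memLp_of_continuousOn H.continuousOn_f).coeFn_toLp, hu.coeFn_toLp] with s h1 h2
  rw [h1, cutoffLp, h2]
  exact norm_indicator_le_norm_self _ _

theorem psi_eq_inner (i : Idx) {t : ℝ} (ht : t ∈ Icc (0 : ℝ) 1) :
    psi P Γ a i t = g a t * inner ℝ (H.cutoffLp t) (H.phiLp P i) := by
  rw [H.psi_eq P i ht, H.inner_cutoffLp ht,
    intervalIntegral_congr_of_ae (H.coeFn_phiLp P i) _ (by simp) ht]

theorem sum_psi_eq (ξ : L2Seq) (F : Finset Idx) {t : ℝ} (ht : t ∈ Icc (0 : ℝ) 1) :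
    ∑ i ∈ F, psi P Γ a i t * ξ i =
      g a t * inner ℝ (H.cutoffLp t) (∑ i ∈ F, ξ i • H.phiLp P i) := by
  rw [inner_sum, Finset.mul_sum]
  refine Finset.sum_congr rfl fun i _ => ?_
  rw [H.psi_eq_inner P i ht, inner_smul_right]
  ring

theorem construction_eq (ξ : L2Seq) {t : ℝ} (ht : t ∈ Icc (0 : ℝ) 1) :
    construction P Γ a ξ t = g a t * inner ℝ (H.cutoffLp t) ((H.basis P).repr.symm ξ) := by
  refine HasSum.tsum_eq ?_
  have h1 := ((H.hasSum_basis P ξ).mapL (innerSL ℝ (H.cutoffLp t))).mul_left (g a t)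
  refine h1.congr_fun ?_
  intro i
  rw [H.psi_eq_inner P i ht, innerSL_apply_apply, inner_smul_right]
  ring

theorem tendstoUniformlyOn_construction (ξ : L2Seq) : TendstoUniformlyOn
    (fun (F : Finset Idx) (t : ℝ) => ∑ i ∈ F, psi P Γ a i t * ξ i)
    (construction P Γ a ξ) atTop (Icc 0 1) := by
  obtain ⟨C, hC0, hC⟩ := exists_bound_of_continuousOn H.continuousOn_g
  set D := ‖(memLp_of_continuousOn H.continuousOn_f).toLp (f Γ a)‖
  have h : Tendsto (fun F : Finset Idx => ∑ i ∈ F, ξ i • H.phiLp P i) atTop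
    (𝓝 ((H.basis P).repr.symm ξ)) := H.hasSum_basis P ξ
  have h1 := ((tendsto_iff_norm_sub_tendsto_zero.1 h).const_mul (C * D))
  rw [mul_zero] at h1
  rw [Metric.tendstoUniformlyOn_iff]
  intro ε hε
  filter_upwards [h1.eventually (gt_mem_nhds hε)] with F hF t ht
  rw [H.sum_psi_eq P ξ F ht, H.construction_eq P ξ ht, dist_comm, Real.dist_eq, ← mul_sub,
    ← inner_sub_right, abs_mul]
  refine lt_of_le_of_lt ?_ hF
  rw [mul_assoc]
  refine mul_le_mul (hC t ht) ((abs_real_inner_le_norm _ _).trans ?_) (abs_nonneg _) hC0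
  exact mul_le_mul_of_nonneg_right (H.norm_cutoffLp_le t) (norm_nonneg _)

end Regular

/-! ### Nuclear operators and their trace -/

section Nuclear

variable {E F : Type} [NormedAddCommGroup E] [InnerProductSpace ℝ E]
  [NormedAddCommGroup F] [InnerProductSpace ℝ F]

/-- `T` has a nuclear representation whose trace is `τ`. -/
def IsNuclearWithTrace (T : E →L[ℝ] E) (τ : ℝ) : Prop :=
  ∃ (ι : Type) (_ : Countable ι) (a b : ι → E), Summable (fun i => ‖a i‖ * ‖b i‖) ∧
    (∀ x : E, HasSum (fun i => inner ℝ (a i) x • b i) (T x)) ∧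
    HasSum (fun i => inner ℝ (a i) (b i)) τ

namespace IsNuclearWithTrace

variable {T : E →L[ℝ] E} {τ : ℝ}

/-- A countable index type is embedded in ℕ and the families are extended by zero. -/
theorem isTraceClass (hT : IsNuclearWithTrace T τ) : IsTraceClass T := by
  obtain ⟨ι, _, a, b, h1, h2, -⟩ := hT
  obtain ⟨e, he⟩ := Countable.exists_injective_nat ι
  have ha : ∀ i, Function.extend e a 0 (e i) = a i := he.extend_apply a 0
  have hb : ∀ i, Function.extend e b 0 (e i) = b i := he.extend_apply b 0
  have h0 : ∀ n ∉ range e, Function.extend e a 0 n = 0 := fun n hn =>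
    Function.extend_apply' _ _ _ hn
  refine ⟨Function.extend e a 0, Function.extend e b 0, ?_, fun x => ?_⟩
  · rw [← he.summable_iff fun n hn => by simp [h0 n hn]]
    simpa only [Function.comp_def, ha, hb] using h1
  · rw [← he.hasSum_iff fun n hn => by simp [h0 n hn]]
    simpa only [Function.comp_def, ha, hb] using h2 x

theorem conj (hT : IsNuclearWithTrace T τ) (e : F ≃ₗᵢ[ℝ] E) :
    IsNuclearWithTrace ((e.symm : E →L[ℝ] F) ∘L T ∘L (e : F →L[ℝ] E)) τ := by
  obtain ⟨ι, hι, a, b, h1, h2, h3⟩ := hT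
  refine ⟨ι, hι, fun i => e.symm (a i), fun i => e.symm (b i), by simpa using h1, fun x => ?_,
    by simpa using h3⟩
  refine ((h2 (e x)).mapL (e.symm : E →L[ℝ] F)).congr_fun fun i => ?_
  have : inner ℝ (e.symm (a i)) x = inner ℝ (a i) (e x) := by
    rw [← e.inner_map_map, e.apply_symm_apply]
  simp [this]

end IsNuclearWithTrace

/-- Cauchy–Schwarz for the finite sum, then Bessel for each factor. -/
theorem HilbertBasis.sum_abs_inner_mul_inner_le {ι : Type} (e : HilbertBasis ι ℝ E) (a b : E)
    (s : Finset ι) : ∑ i ∈ s, |inner ℝ a (e i) * inner ℝ (e i) b| ≤ ‖a‖ * ‖b‖ := by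
  have h1 := e.orthonormal.sum_inner_products_le (s := s) a
  have h2 := e.orthonormal.sum_inner_products_le (s := s) b
  have h3 := Finset.sum_mul_sq_le_sq_mul_sq s (fun i => ‖inner ℝ (e i) a‖)
    (fun i => ‖inner ℝ (e i) b‖)
  have h4 : ∑ i ∈ s, |inner ℝ a (e i) * inner ℝ (e i) b|
      = ∑ i ∈ s, ‖inner ℝ (e i) a‖ * ‖inner ℝ (e i) b‖ :=
    Finset.sum_congr rfl fun i _ => by
      rw [abs_mul, real_inner_comm, Real.norm_eq_abs, Real.norm_eq_abs]
  rw [h4]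
  refine abs_le_of_sq_le_sq' ?_ (by positivity) |>.2
  calc _ ≤ _ := h3
    _ ≤ ‖a‖ ^ 2 * ‖b‖ ^ 2 := mul_le_mul h1 h2 (by positivity) (by positivity)
    _ = _ := by ring

/-- Fubini for the family ⟨a_n, e_i⟩ ⟨e_i, b_n⟩, absolutely summable by the previous bound: summing
over i first gives ∑ ⟨a_n, b_n⟩ = τ, over n first gives ∑ ⟨e_i, T e_i⟩. -/
theorem IsNuclearWithTrace.hasTrace {T : E →L[ℝ] E} {τ : ℝ} (hT : IsNuclearWithTrace T τ) :
    HasTrace T τ := by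
  obtain ⟨κ, _, a, b, h1, h2, h3⟩ := hT
  intro ι e
  set c : κ × ι → ℝ := fun p => inner ℝ (a p.1) (e p.2) * inner ℝ (e p.2) (b p.1) with hc
  have hsum : ∀ n, HasSum (fun i => c (n, i)) (inner ℝ (a n) (b n)) := fun n =>
    e.hasSum_inner_mul_inner (a n) (b n)
  have habs : ∀ n, Summable (fun i => |c (n, i)|) := fun n => (hsum n).summable.abs
  have hS : Summable c := by
    rw [← summable_abs_iff, summable_prod_of_nonneg fun p => abs_nonneg _]
    refine ⟨habs, Summable.of_nonneg_of_le (fun n => tsum_nonneg fun i => abs_nonneg _)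
      (fun n => ?_) h1⟩
    exact (habs n).tsum_le_of_sum_le fun s =>
      HilbertBasis.sum_abs_inner_mul_inner_le e (a n) (b n) s
  have hτ : HasSum c τ := by
    have := hS.hasSum.prod_fiberwise hsum
    rw [h3.unique this]
    exact hS.hasSum
  have hswap : HasSum (fun p : ι × κ => c p.swap) τ :=
    (Equiv.prodComm ι κ).hasSum_iff.2 hτ
  refine hswap.prod_fiberwise fun i => ?_
  refine ((h2 (e i)).mapL (innerSL ℝ (e i))).congr_fun fun n => ?_
  simp [hc]

end Nuclear

/-! ### Integral operators with bounded kernels -/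

section Kernel

/-- A bounded measurable kernel. -/
structure BoundedKernel (k : ℝ → ℝ → ℝ) (C : ℝ) : Prop where
  measurable : Measurable (Function.uncurry k)
  bound : ∀ t s, |k t s| ≤ C

namespace BoundedKernel

variable {k : ℝ → ℝ → ℝ} {C : ℝ}

theorem transpose (hk : BoundedKernel k C) : BoundedKernel (fun t s => k s t) C :=
  ⟨hk.measurable.comp measurable_swap, fun t s => hk.bound s t⟩

theorem measurable_slice (hk : BoundedKernel k C) (t : ℝ) : Measurable (k t) :=
  hk.measurable.comp (measurable_const.prodMk measurable_id)

theorem nonneg (hk : BoundedKernel k C) : 0 ≤ C := (abs_nonneg _).trans (hk.bound 0 0)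

end BoundedKernel

theorem norm_toLp_le_of_bound {u : ℝ → ℝ} (hu : MemLp u 2 μ₀) {C : ℝ} (hC0 : 0 ≤ C)
    (hC : ∀ᵐ t ∂μ₀, |u t| ≤ C) : ‖hu.toLp u‖ ≤ C := by
  have h := Lp.norm_le_of_ae_bound (f := hu.toLp u) hC0 (by
    filter_upwards [hu.coeFn_toLp, hC] with t h1 h2
    rw [h1]; exact h2)
  simpa [measureUnivNNReal] using h

/-- Cauchy-Schwarz for the pairing of a bounded function with an element of `L²[0,1]`. -/
theorem abs_integral_mul_le {u : ℝ → ℝ} (hu : AEStronglyMeasurable u μ₀) {C : ℝ} (hC0 : 0 ≤ C)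
    (hC : ∀ᵐ t ∂μ₀, |u t| ≤ C) (x : L2Unit) : |∫ t, u t * x t ∂μ₀| ≤ C * ‖x‖ := by
  have hm : MemLp u 2 μ₀ := MemLp.of_bound hu C hC
  rw [← inner_toLp hm]
  exact (abs_real_inner_le_norm _ _).trans
    (mul_le_mul_of_nonneg_right (norm_toLp_le_of_bound hm hC0 hC) (norm_nonneg _))

theorem integrable_bounded_mul {u z : ℝ → ℝ} (hu : AEStronglyMeasurable u μ₀) {C : ℝ}
    (hC : ∀ t, |u t| ≤ C) (hz : Integrable z μ₀) : Integrable (fun t => u t * z t) μ₀ :=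
  hz.bdd_mul hu (Eventually.of_forall hC)

namespace BoundedKernel

variable {k : ℝ → ℝ → ℝ} {C : ℝ} (hk : BoundedKernel k C)
include hk

theorem integrable_slice_mul (x : L2Unit) (t : ℝ) : Integrable (fun s => k t s * x s) μ₀ :=
  integrable_bounded_mul (hk.measurable_slice t).aestronglyMeasurable (hk.bound t)
    (integrable_coe x)

theorem abs_integral_le (x : L2Unit) (t : ℝ) : |∫ s, k t s * x s ∂μ₀| ≤ C * ‖x‖ :=
  abs_integral_mul_le (hk.measurable_slice t).aestronglyMeasurable hk.nonneg
    (Eventually.of_forall (hk.bound t)) x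

theorem memLp_integral (x : L2Unit) : MemLp (fun t => ∫ s, k t s * x s ∂μ₀) 2 μ₀ := by
  refine MemLp.of_bound ?_ (C * ‖x‖) (Eventually.of_forall (hk.abs_integral_le x))
  refine StronglyMeasurable.aestronglyMeasurable ?_
  refine StronglyMeasurable.integral_prod_right
    (f := fun t s => k t s * x s) ?_
  exact hk.measurable.stronglyMeasurable.mul
    ((Lp.stronglyMeasurable x).comp_measurable measurable_snd)

/-- The integral operator with a bounded kernel. -/
noncomputable def op : L2Unit →L[ℝ] L2Unit :=
  LinearMap.mkContinuous
    { toFun := fun x => (hk.memLp_integral x).toLp _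
      map_add' := fun x y => by
        rw [← MemLp.toLp_add]
        refine MemLp.toLp_congr _ _ (Eventually.of_forall fun t => ?_)
        simp only [Pi.add_apply]
        rw [← integral_add (hk.integrable_slice_mul x t) (hk.integrable_slice_mul y t)]
        refine integral_congr_ae ?_
        filter_upwards [Lp.coeFn_add x y] with s hs
        rw [hs, Pi.add_apply]; ring
      map_smul' := fun c x => by
        rw [← MemLp.toLp_const_smul]
        refine MemLp.toLp_congr _ _ (Eventually.of_forall fun t => ?_)
        simp only [Pi.smul_apply, RingHom.id_apply, smul_eq_mul]
        rw [← integral_const_mul]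
        refine integral_congr_ae ?_
        filter_upwards [Lp.coeFn_smul c x] with s hs
        rw [hs, Pi.smul_apply, smul_eq_mul]; ring }
    C fun x => norm_toLp_le_of_bound (hk.memLp_integral x) (mul_nonneg hk.nonneg (norm_nonneg _))
      (Eventually.of_forall (hk.abs_integral_le x))

theorem coeFn_op (x : L2Unit) : hk.op x =ᵐ[μ₀] fun t => ∫ s, k t s * x s ∂μ₀ :=
  (hk.memLp_integral x).coeFn_toLp

/-- Almost everywhere equality of slices suffices, so kernels may differ on the diagonal. -/
theorem op_congr {k' : ℝ → ℝ → ℝ} {C' : ℝ} (hk' : BoundedKernel k' C')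
    (h : ∀ t ∈ Icc (0 : ℝ) 1, k t =ᵐ[μ₀] k' t) : hk.op = hk'.op := by
  ext1 x
  refine Lp.ext ?_
  filter_upwards [hk.coeFn_op x, hk'.coeFn_op x, ae_restrict_mem measurableSet_Icc]
    with t h1 h2 ht
  rw [h1, h2]
  refine integral_congr_ae ?_
  filter_upwards [h t ht] with s hs
  rw [hs]

theorem add {k' : ℝ → ℝ → ℝ} {C' : ℝ} (hk' : BoundedKernel k' C') :
    BoundedKernel (fun t s => k t s + k' t s) (C + C') :=
  ⟨hk.measurable.add hk'.measurable, fun t s =>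
    (abs_add_le _ _).trans (add_le_add (hk.bound t s) (hk'.bound t s))⟩

theorem op_add {k' : ℝ → ℝ → ℝ} {C' : ℝ} (hk' : BoundedKernel k' C') :
    (hk.add hk').op = hk.op + hk'.op := by
  ext1 x
  refine Lp.ext ?_
  filter_upwards [hk.coeFn_op x, hk'.coeFn_op x, (hk.add hk').coeFn_op x,
    Lp.coeFn_add (hk.op x) (hk'.op x)] with t h1 h2 h3 h4
  rw [add_apply, h4, h3, Pi.add_apply, h1, h2,
    ← integral_add (hk.integrable_slice_mul x t) (hk'.integrable_slice_mul x t)]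
  simp only [add_mul]

theorem integrable_prod {y z : ℝ → ℝ} (hy : Integrable y μ₀) (hz : Integrable z μ₀) :
    Integrable (fun p : ℝ × ℝ => k p.1 p.2 * (y p.1 * z p.2)) (Measure.prod μ₀ μ₀) :=
  (hy.mul_prod hz).bdd_mul hk.measurable.aestronglyMeasurable
    (Eventually.of_forall fun p => hk.bound p.1 p.2)

theorem inner_op (x y : L2Unit) :
    inner ℝ (hk.op x) y = ∫ t, ∫ s, k t s * (y t * x s) ∂μ₀ ∂μ₀ := by
  rw [L2.inner_def]
  refine integral_congr_ae ?_
  filter_upwards [hk.coeFn_op x] with t ht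
  rw [ht]
  simp only [RCLike.inner_apply, conj_trivial]
  rw [← integral_const_mul]
  exact integral_congr_ae (Eventually.of_forall fun s => by ring)

theorem adjoint_op : ContinuousLinearMap.adjoint hk.op = hk.transpose.op := by
  refine ((ContinuousLinearMap.eq_adjoint_iff _ _).2 fun x y => ?_).symm
  rw [real_inner_comm (hk.op y), hk.inner_op, hk.transpose.inner_op, integral_integral_swap]
  · refine integral_congr_ae (Eventually.of_forall fun t => ?_)
    exact integral_congr_ae (Eventually.of_forall fun s => by ring)
  · exact hk.transpose.integrable_prod (integrable_coe y) (integrable_coe x)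

theorem comp {k' : ℝ → ℝ → ℝ} {C' : ℝ} (hk' : BoundedKernel k' C') :
    BoundedKernel (fun t s => ∫ u, k t u * k' u s ∂μ₀) (C * C') := by
  refine ⟨?_, fun t s => ?_⟩
  · refine StronglyMeasurable.measurable ?_
    refine StronglyMeasurable.integral_prod_right (f := fun p : ℝ × ℝ => fun u =>
      k p.1 u * k' u p.2) ?_
    refine Measurable.stronglyMeasurable ?_
    exact (hk.measurable.comp (by fun_prop : Measurable fun q : (ℝ × ℝ) × ℝ => (q.1.1, q.2))).mul
      (hk'.measurable.comp (by fun_prop : Measurable fun q : (ℝ × ℝ) × ℝ => (q.2, q.1.2)))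
  · have := norm_integral_le_of_norm_le_const (μ := μ₀) (f := fun u => k t u * k' u s)
      (C := C * C') (Eventually.of_forall fun u => by
        rw [norm_mul]
        exact mul_le_mul (hk.bound _ _) (hk'.bound _ _) (abs_nonneg _) hk.nonneg)
    simpa using this

theorem op_comp {k' : ℝ → ℝ → ℝ} {C' : ℝ} (hk' : BoundedKernel k' C') :
    hk.op ∘L hk'.op = (hk.comp hk').op := by
  ext1 x
  refine Lp.ext ?_
  filter_upwards [hk.coeFn_op (hk'.op x), (hk.comp hk').coeFn_op x] with t h1 h2
  rw [ContinuousLinearMap.comp_apply, h1, h2]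
  have h3 : ∫ u, k t u * hk'.op x u ∂μ₀ = ∫ u, ∫ s, k' u s * (k t u * x s) ∂μ₀ ∂μ₀ := by
    refine integral_congr_ae ?_
    filter_upwards [hk'.coeFn_op x] with u hu
    rw [hu, ← integral_const_mul]
    exact integral_congr_ae (Eventually.of_forall fun s => by ring)
  rw [h3, integral_integral_swap]
  · refine integral_congr_ae (Eventually.of_forall fun s => ?_)
    simp only
    rw [← integral_mul_const]
    exact integral_congr_ae (Eventually.of_forall fun u => by ring)
  · refine hk'.integrable_prod ?_ (integrable_coe x)
    exact Integrable.of_bound (hk.measurable_slice t).aestronglyMeasurable C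
      (Eventually.of_forall (hk.bound t))

end BoundedKernel

end Kernel

namespace IsNuclearWithTrace

variable {E : Type} [NormedAddCommGroup E] [InnerProductSpace ℝ E]

theorem add {T T' : E →L[ℝ] E} {τ τ' : ℝ} (hT : IsNuclearWithTrace T τ)
    (hT' : IsNuclearWithTrace T' τ') : IsNuclearWithTrace (T + T') (τ + τ') := by
  obtain ⟨ι, _, a, b, h1, h2, h3⟩ := hT
  obtain ⟨κ, _, a', b', h1', h2', h3'⟩ := hT'
  exact ⟨ι ⊕ κ, inferInstance, Sum.elim a a', Sum.elim b b', Summable.sum _ h1 h1',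
    fun x => HasSum.sum (h2 x) (h2' x), HasSum.sum h3 h3'⟩

theorem rankOne (a b : E) : IsNuclearWithTrace ((innerSL ℝ a).smulRight b) (inner ℝ a b) :=
  ⟨Unit, inferInstance, fun _ => a, fun _ => b, (hasSum_fintype _).summable,
    fun x => by simp,
    by simp⟩

/-- For an absolutely summable family of rank one operators it is enough to compute the sums along
one exhaustion of the index set. -/
theorem of_exhaustion [CompleteSpace E] {ι : Type} [Countable ι] {a b : ι → E}
    (hab : Summable fun i => ‖a i‖ * ‖b i‖) {F : ℕ → Finset ι} (hF : Tendsto F atTop atTop)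
    {T : E →L[ℝ] E} {τ : ℝ}
    (hT : ∀ x, Tendsto (fun N => ∑ i ∈ F N, inner ℝ (a i) x • b i) atTop (𝓝 (T x)))
    (hτ : Tendsto (fun N => ∑ i ∈ F N, inner ℝ (a i) (b i)) atTop (𝓝 τ)) :
    IsNuclearWithTrace T τ := by
  refine ⟨ι, inferInstance, a, b, hab, fun x => ?_, ?_⟩
  · have hs : Summable fun i => inner ℝ (a i) x • b i := by
      refine Summable.of_norm_bounded (hab.mul_right ‖x‖) fun i => ?_
      rw [norm_smul]
      calc _ ≤ (‖a i‖ * ‖x‖) * ‖b i‖ :=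
            mul_le_mul_of_nonneg_right (norm_inner_le_norm _ _) (norm_nonneg _)
        _ = _ := by ring
    have := hs.hasSum
    rwa [tendsto_nhds_unique (hs.hasSum.comp hF) (hT x)] at this
  · have hs : Summable fun i => inner ℝ (a i) (b i) :=
      Summable.of_norm_bounded hab fun i => norm_inner_le_norm _ _
    have := hs.hasSum
    rwa [tendsto_nhds_unique (hs.hasSum.comp hF) hτ] at this

end IsNuclearWithTrace

/-! ### Dyadic decomposition of kernels V(t ∨ s) f(t) f(s) -/

/-- The indicator function of the dyadic interval `[k / 2 ^ n, (k + 1) / 2 ^ n)`. -/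
noncomputable def dyadicInd (n k : ℕ) (t : ℝ) : ℝ := if ⌊2 ^ n * t⌋₊ = k then 1 else 0

theorem dyadicInd_eq_indicator (n k : ℕ) :
    dyadicInd n k = {t : ℝ | ⌊2 ^ n * t⌋₊ = k}.indicator 1 := by
  ext t
  simp [dyadicInd, indicator]

theorem measurableSet_dyadic (n k : ℕ) : MeasurableSet {t : ℝ | ⌊2 ^ n * t⌋₊ = k} :=
  (Nat.measurable_floor.comp (measurable_const_mul _)) (measurableSet_singleton k)

theorem measurable_dyadicInd (n k : ℕ) : Measurable (dyadicInd n k) := by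
  rw [dyadicInd_eq_indicator]
  exact measurable_one.indicator (measurableSet_dyadic n k)

theorem dyadicInd_nonneg (n k : ℕ) (t : ℝ) : 0 ≤ dyadicInd n k t := by
  unfold dyadicInd; split_ifs <;> simp

theorem dyadicInd_le_one (n k : ℕ) (t : ℝ) : dyadicInd n k t ≤ 1 := by
  unfold dyadicInd; split_ifs <;> simp

theorem mem_of_floor_eq {n k : ℕ} {t : ℝ} (ht : 0 ≤ t) (h : ⌊2 ^ n * t⌋₊ = k) :
    (k : ℝ) / 2 ^ n ≤ t ∧ t ≤ k / 2 ^ n + (1 / 2) ^ n := by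
  have h1 := (Nat.floor_eq_iff (by positivity)).1 h
  constructor
  · rw [div_le_iff₀ (by positivity)]; linarith
  · rw [one_div, inv_pow, ← one_div, ← add_div, le_div_iff₀ (by positivity)]; linarith

theorem integral_dyadicInd_le (n k : ℕ) : ∫ t, dyadicInd n k t ∂μ₀ ≤ (1 / 2) ^ n := by
  rw [dyadicInd_eq_indicator, integral_indicator_one (measurableSet_dyadic n k),
    measureReal_restrict_apply (measurableSet_dyadic n k)]
  calc _ ≤ volume.real (Icc ((k : ℝ) / 2 ^ n) (k / 2 ^ n + (1 / 2) ^ n)) :=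
        measureReal_mono (fun t ht => mem_of_floor_eq ht.2.1 ht.1) (by simp)
    _ = _ := by
        rw [Measure.real, Real.volume_Icc, ENNReal.toReal_ofReal] <;> simp

theorem norm_sq_toLp_le {u : ℝ → ℝ} (hu : MemLp u 2 μ₀) {B : ℝ} {n k : ℕ}
    (h : ∀ t ∈ Icc (0 : ℝ) 1, |u t| ≤ B * dyadicInd n k t) :
    ‖hu.toLp u‖ ^ 2 ≤ B ^ 2 * (1 / 2) ^ n := by
  have h1 : ‖hu.toLp u‖ ^ 2 = ∫ t, u t ^ 2 ∂μ₀ := by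
    rw [← real_inner_self_eq_norm_sq, inner_toLp]
    refine integral_congr_ae ?_
    filter_upwards [hu.coeFn_toLp] with t ht
    rw [ht, sq]
  rw [h1]
  have hi : Integrable (dyadicInd n k) μ₀ :=
    Integrable.of_bound (measurable_dyadicInd n k).aestronglyMeasurable 1
      (Eventually.of_forall fun t => by
        rw [Real.norm_eq_abs, abs_of_nonneg (dyadicInd_nonneg n k t)]
        exact dyadicInd_le_one n k t)
  calc ∫ t, u t ^ 2 ∂μ₀ ≤ ∫ t, B ^ 2 * dyadicInd n k t ∂μ₀ := by
        refine integral_mono_ae hu.integrable_sq (hi.const_mul _) ?_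
        filter_upwards [ae_restrict_mem measurableSet_Icc] with t ht
        have h2 := sq_le_sq' (by linarith [abs_nonneg (u t), h t ht]) (h t ht)
        rw [sq_abs, mul_pow] at h2
        refine h2.trans (le_of_eq ?_)
        unfold dyadicInd; split_ifs <;> simp
    _ = B ^ 2 * ∫ t, dyadicInd n k t ∂μ₀ := integral_const_mul _ _
    _ ≤ _ := mul_le_mul_of_nonneg_left (integral_dyadicInd_le n k) (sq_nonneg _)

/-- The remainder kernel of generation `n`: `V(t ∨ s) - V(c)` on the diagonal dyadic squares with
lower left corner `(c, c)`, and `0` off them. -/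
noncomputable def remainder (V : ℝ → ℝ) (n : ℕ) (t s : ℝ) : ℝ :=
  if ⌊2 ^ n * t⌋₊ = ⌊2 ^ n * s⌋₊ then V (max t s) - V (⌊2 ^ n * t⌋₊ / 2 ^ n) else 0

theorem floor_succ_div_two (n : ℕ) (t : ℝ) : ⌊(2 : ℝ) ^ (n + 1) * t⌋₊ / 2 = ⌊2 ^ n * t⌋₊ := by
  rw [← Nat.floor_div_ofNat]
  congr 1
  rw [pow_succ]; ring

theorem floor_lt {n : ℕ} {t : ℝ} (h0 : 0 ≤ t) (h1 : t < 1) : ⌊(2 : ℝ) ^ n * t⌋₊ < 2 ^ n := by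
  rw [Nat.floor_lt (by positivity)]
  push_cast
  have : (0 : ℝ) < 2 ^ n := by positivity
  nlinarith

theorem lt_of_floor_lt {n : ℕ} {t s : ℝ} (h : ⌊(2 : ℝ) ^ n * t⌋₊ < ⌊(2 : ℝ) ^ n * s⌋₊) :
    t < s := by
  by_contra hts
  have : (2 : ℝ) ^ n * s ≤ 2 ^ n * t :=
    mul_le_mul_of_nonneg_left (not_lt.1 hts) (by positivity)
  exact absurd (Nat.floor_le_floor this) (not_le.2 h)

/-- Index set of the rank one operators in the decomposition: three for each dyadic interval. -/
abbrev DyadicIdx : Type := Σ n : ℕ, Fin (2 ^ n) × Fin 3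

/-- The first factors of the rank one operators. -/
noncomputable def dyadicLeft (V f : ℝ → ℝ) (i : DyadicIdx) (t : ℝ) : ℝ :=
  ![dyadicInd (i.1 + 1) (2 * i.2.1) t,
    dyadicInd (i.1 + 1) (2 * i.2.1 + 1) t * (V t - V (i.2.1 / 2 ^ i.1)),
    dyadicInd (i.1 + 1) (2 * i.2.1 + 1) t] i.2.2 * f t

/-- The second factors of the rank one operators. -/
noncomputable def dyadicRight (V f : ℝ → ℝ) (i : DyadicIdx) (t : ℝ) : ℝ :=
  ![dyadicInd (i.1 + 1) (2 * i.2.1 + 1) t * (V t - V (i.2.1 / 2 ^ i.1)),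
    dyadicInd (i.1 + 1) (2 * i.2.1) t,
    dyadicInd (i.1 + 1) (2 * i.2.1 + 1) t * (V ((2 * i.2.1 + 1) / 2 ^ (i.1 + 1))
      - V (i.2.1 / 2 ^ i.1))] i.2.2 * f t

/-- Quarter a diagonal square with corner c. On the two off-diagonal quarters t ∨ s is the
coordinate in the right half, so V(t ∨ s) - V(c) is a product. On the upper right quarter the corner
moves to c' and the constant V(c') - V(c) is left over. The lower left quarter keeps its corner and
leaves nothing. Hence three terms per square. -/
theorem sum_level (V f : ℝ → ℝ) (n : ℕ) {t s : ℝ} (ht0 : 0 ≤ t) (ht1 : t < 1) :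
    ∑ j : Fin (2 ^ n) × Fin 3, dyadicRight V f ⟨n, j⟩ t * dyadicLeft V f ⟨n, j⟩ s
      = (remainder V n t s - remainder V (n + 1) t s) * (f t * f s) := by
  have hpt := floor_succ_div_two n t
  have hps := floor_succ_div_two n s
  have hlt := floor_lt (n := n) ht0 ht1
  have hts := @lt_of_floor_lt (n + 1) t s
  have hst := @lt_of_floor_lt (n + 1) s t
  unfold remainder
  generalize hu : ⌊(2 : ℝ) ^ n * t⌋₊ = u at *
  -- Only the interval containing t contributes; t < 1 makes its number a valid index.
  rw [Fintype.sum_prod_type, Finset.sum_eq_single ⟨u, hlt⟩]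
  · simp only [Fin.sum_univ_three, dyadicRight, dyadicLeft, dyadicInd,
      Matrix.cons_val_zero, Matrix.cons_val_one, Matrix.cons_val]
    generalize hp : ⌊(2 : ℝ) ^ (n + 1) * t⌋₊ = p at *
    generalize hq : ⌊(2 : ℝ) ^ (n + 1) * s⌋₊ = q at *
    generalize ⌊(2 : ℝ) ^ n * s⌋₊ = w at *
    have hpu : p = 2 * u ∨ p = 2 * u + 1 := by omega
    have hqw : q = 2 * w ∨ q = 2 * w + 1 := by omega
    clear hp hq hu hpt hps
    by_cases huw : u = w
    · subst huw
      rcases hpu with rfl | rfl <;> rcases hqw with rfl | rfl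
      -- Both points are in the left half: the corner is unchanged and the two remainders cancel.
      · have : ((2 * u : ℕ) : ℝ) / 2 ^ (n + 1) = u / 2 ^ n := by
          push_cast; rw [pow_succ]; field_simp
        rw [this]
        simp
      · have := max_eq_right (hts (by omega)).le
        simp [this]
        ring
      · have := max_eq_left (hst (by omega)).le
        simp [this]
        ring
      · simp
        ring
    · have h1 : ¬ p = q := by omega
      rw [if_neg huw, if_neg h1]
      rcases hpu with rfl | rfl
      · have h2 : q ≠ 2 * u + 1 := by omega
        simp [h2]
      · have h2 : q ≠ 2 * u + 1 := by omega
        have h3 : q ≠ 2 * u := by omega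
        simp [h2, h3]
  · intro k _ hk
    have hk' : ⌊(2 : ℝ) ^ n * t⌋₊ = u := hu
    have hne : (k : ℕ) ≠ u := fun h => hk (Fin.ext h)
    have h1 : ⌊(2 : ℝ) ^ (n + 1) * t⌋₊ ≠ 2 * k := by omega
    have h2 : ⌊(2 : ℝ) ^ (n + 1) * t⌋₊ ≠ 2 * k + 1 := by omega
    simp [Fin.sum_univ_three, dyadicRight, dyadicInd, h1, h2]
  · simp

/-- Bounded continuous functions `V` and `f`, where the dyadic modulus of continuity of `V` on
`[0,1]` decays geometrically. -/
structure DyadicData (V f : ℝ → ℝ) (M C θ : ℝ) : Prop where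
  continuous_V : Continuous V
  continuous_f : Continuous f
  bound_f : ∀ t, |f t| ≤ M
  C_nonneg : 0 ≤ C
  θ_nonneg : 0 ≤ θ
  θ_lt_one : θ < 1
  modulus : ∀ n : ℕ, ∀ s ∈ Icc (0 : ℝ) 1, ∀ t ∈ Icc (0 : ℝ) 1, |s - t| ≤ (1 / 2) ^ n →
    |V s - V t| ≤ C * θ ^ n

theorem memLp_of_le_dyadicInd {u : ℝ → ℝ} (hu : Measurable u) {A : ℝ}
    (hA : 0 ≤ A) {n k : ℕ} (h : ∀ t ∈ Icc (0 : ℝ) 1, |u t| ≤ A * dyadicInd n k t) :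
    MemLp u 2 μ₀ := by
  refine MemLp.of_bound hu.aestronglyMeasurable A ?_
  filter_upwards [ae_restrict_mem measurableSet_Icc] with t ht
  exact (h t ht).trans (mul_le_of_le_one_right hA (dyadicInd_le_one n k t))

/-- The indices of the first `N` generations. -/
def dyadicLevels (N : ℕ) : Finset DyadicIdx :=
  (Finset.range N).sigma fun _ => Finset.univ

theorem tendsto_dyadicLevels : Tendsto dyadicLevels atTop atTop := by
  refine tendsto_atTop_finset_of_monotone (fun m n hmn => ?_) fun i => ⟨i.1 + 1, ?_⟩
  · exact Finset.sigma_mono (Finset.range_mono hmn) fun _ => le_rfl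
  · simp [dyadicLevels]

/-- The levels telescope, starting from the single square of generation 0 with corner (0,0); this is
the origin of V(0). -/
theorem sum_dyadicLevels (V f : ℝ → ℝ) (N : ℕ) {t s : ℝ} (ht : t ∈ Ico (0 : ℝ) 1)
    (hs : s ∈ Ico (0 : ℝ) 1) :
    ∑ i ∈ dyadicLevels N, dyadicRight V f i t * dyadicLeft V f i s
      = (V (max t s) - V 0 - remainder V N t s) * (f t * f s) := by
  have h0 : remainder V 0 t s = V (max t s) - V 0 := by
    have h1 : ⌊t⌋₊ = 0 := Nat.floor_eq_zero.2 ht.2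
    have h2 : ⌊s⌋₊ = 0 := Nat.floor_eq_zero.2 hs.2
    simp [remainder, h1, h2]
  rw [dyadicLevels, Finset.sum_sigma, ← h0, ← Finset.sum_range_sub' (fun n => remainder V n t s),
    Finset.sum_mul]
  exact Finset.sum_congr rfl fun n _ => sum_level V f n ht.1 ht.2

/-- The point 1 would fall in dyadic interval number 2ⁿ, which is not indexed. -/
theorem ae_mem_Ico : ∀ᵐ t ∂μ₀, t ∈ Ico (0 : ℝ) 1 := by
  have h1 : ∀ᵐ t ∂μ₀, t ≠ 1 := ae_restrict_of_ae (by simp [ae_iff, measure_singleton])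
  filter_upwards [ae_restrict_mem measurableSet_Icc, h1] with t ht h
  exact ⟨ht.1, lt_of_le_of_ne ht.2 h⟩

namespace DyadicData

variable {V f : ℝ → ℝ} {M C θ : ℝ} (D : DyadicData V f M C θ)
include D

theorem M_nonneg : 0 ≤ M := (abs_nonneg _).trans (D.bound_f 0)

theorem tail_nonneg (n : ℕ) : 0 ≤ C * θ ^ n := mul_nonneg D.C_nonneg (pow_nonneg D.θ_nonneg n)

theorem abs_sub_le {n k : ℕ} {t : ℝ} (ht : t ∈ Icc (0 : ℝ) 1) (h : ⌊2 ^ n * t⌋₊ = k) :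
    |V t - V (k / 2 ^ n)| ≤ C * θ ^ n := by
  obtain ⟨h1, h2⟩ := mem_of_floor_eq ht.1 h
  refine D.modulus n t ht _ ⟨by positivity, h1.trans ht.2⟩ ?_
  rw [abs_of_nonneg (by linarith)]
  linarith

theorem abs_remainder_le (n : ℕ) {t s : ℝ} (ht : t ∈ Icc (0 : ℝ) 1) (hs : s ∈ Icc (0 : ℝ) 1) :
    |remainder V n t s| ≤ C * θ ^ n := by
  unfold remainder
  split_ifs with h
  · rcases max_choice t s with h1 | h1
    · rw [h1]; exact D.abs_sub_le ht rfl
    · rw [h1]; exact D.abs_sub_le hs h.symm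
  · simpa using D.tail_nonneg n

theorem abs_ind_mul_sub_le {n k : ℕ} {t : ℝ} (ht : t ∈ Icc (0 : ℝ) 1) :
    |dyadicInd (n + 1) (2 * k + 1) t * (V t - V (k / 2 ^ n))|
      ≤ C * θ ^ n * dyadicInd (n + 1) (2 * k + 1) t := by
  unfold dyadicInd
  split_ifs with h
  · rw [one_mul, mul_one]
    refine D.abs_sub_le ht ?_
    rw [← floor_succ_div_two, h]
    omega
  · simp

theorem abs_sub_midpoint_le {n k : ℕ} (hk : k < 2 ^ n) :
    |V ((2 * k + 1) / 2 ^ (n + 1)) - V (k / 2 ^ n)| ≤ C * θ ^ n := by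
  have hk' : (k : ℝ) + 1 ≤ 2 ^ n := by exact_mod_cast hk
  have h2 : (0 : ℝ) < 2 ^ n := by positivity
  have h3 : ((2 : ℝ) * k + 1) / 2 ^ (n + 1) = k / 2 ^ n + (1 / 2) ^ n / 2 := by
    rw [pow_succ, one_div, inv_pow]; field_simp
  have h4 : (0 : ℝ) < (1 / 2) ^ n := by positivity
  refine D.modulus n _ ⟨by positivity, ?_⟩ _ ⟨by positivity, ?_⟩ ?_
  · rw [div_le_one (by positivity), pow_succ]; linarith
  · rw [div_le_one (by positivity)]; linarith
  · rw [h3, add_sub_cancel_left, abs_of_pos (by positivity)]; linarith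

theorem abs_ind_mul_f_le {n k : ℕ} {t : ℝ} :
    |dyadicInd n k t * f t| ≤ M * dyadicInd n k t := by
  rw [abs_mul, abs_of_nonneg (dyadicInd_nonneg n k t), mul_comm]
  exact mul_le_mul_of_nonneg_right (D.bound_f t) (dyadicInd_nonneg n k t)

/-- The factors are supported in dyadic intervals of the next generation; one of them is bounded,
the other one is small. -/
theorem exists_bounds (i : DyadicIdx) : ∃ (A B : ℝ) (k k' : ℕ),
    (∀ t ∈ Icc (0 : ℝ) 1, |dyadicLeft V f i t| ≤ A * dyadicInd (i.1 + 1) k t) ∧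
    (∀ t ∈ Icc (0 : ℝ) 1, |dyadicRight V f i t| ≤ B * dyadicInd (i.1 + 1) k' t) ∧
    0 ≤ A ∧ 0 ≤ B ∧ A * B = M ^ 2 * C * θ ^ i.1 := by
  obtain ⟨n, k, j⟩ := i
  have hM := D.M_nonneg
  have hT := D.tail_nonneg n
  have h1 : ∀ t ∈ Icc (0 : ℝ) 1,
      |dyadicInd (n + 1) (2 * k + 1) t * (V t - V (k / 2 ^ n)) * f t|
        ≤ M * (C * θ ^ n) * dyadicInd (n + 1) (2 * k + 1) t := by
    intro t ht
    rw [abs_mul, mul_comm, mul_assoc]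
    exact mul_le_mul (D.bound_f t) (D.abs_ind_mul_sub_le ht) (abs_nonneg _) hM
  have h2 : ∀ t, |dyadicInd (n + 1) (2 * k + 1) t *
      (V ((2 * k + 1) / 2 ^ (n + 1)) - V (k / 2 ^ n)) * f t|
        ≤ M * (C * θ ^ n) * dyadicInd (n + 1) (2 * k + 1) t := by
    intro t
    rw [mul_right_comm, abs_mul, mul_right_comm M]
    exact mul_le_mul D.abs_ind_mul_f_le (D.abs_sub_midpoint_le k.2) (abs_nonneg _)
      (mul_nonneg hM (dyadicInd_nonneg _ _ _))
  fin_cases j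
  · exact ⟨M, M * (C * θ ^ n), 2 * k, 2 * k + 1, fun t _ => D.abs_ind_mul_f_le, h1, hM,
      by positivity, by ring⟩
  · exact ⟨M * (C * θ ^ n), M, 2 * k + 1, 2 * k, h1, fun t _ => D.abs_ind_mul_f_le,
      by positivity, hM, by ring⟩
  · exact ⟨M, M * (C * θ ^ n), 2 * k + 1, 2 * k + 1, fun t _ => D.abs_ind_mul_f_le,
      fun t _ => h2 t, hM, by positivity, by ring⟩

theorem measurable_dyadicLeft (i : DyadicIdx) : Measurable (dyadicLeft V f i) := by
  obtain ⟨n, k, j⟩ := i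
  have hV := D.continuous_V.measurable
  have hf := D.continuous_f.measurable
  fin_cases j
  · exact (measurable_dyadicInd _ _).mul hf
  · exact ((measurable_dyadicInd _ _).mul (hV.sub_const _)).mul hf
  · exact (measurable_dyadicInd _ _).mul hf

theorem measurable_dyadicRight (i : DyadicIdx) : Measurable (dyadicRight V f i) := by
  obtain ⟨n, k, j⟩ := i
  have hV := D.continuous_V.measurable
  have hf := D.continuous_f.measurable
  fin_cases j
  · exact ((measurable_dyadicInd _ _).mul (hV.sub_const _)).mul hf
  · exact (measurable_dyadicInd _ _).mul hf
  · exact ((measurable_dyadicInd _ _).mul_const _).mul hf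

theorem memLp_left (i : DyadicIdx) : MemLp (dyadicLeft V f i) 2 μ₀ := by
  obtain ⟨A, B, k, k', h1, -, hA, -⟩ := D.exists_bounds i
  exact memLp_of_le_dyadicInd (D.measurable_dyadicLeft i) hA h1

theorem memLp_right (i : DyadicIdx) : MemLp (dyadicRight V f i) 2 μ₀ := by
  obtain ⟨A, B, k, k', -, h1, -, hB, -⟩ := D.exists_bounds i
  exact memLp_of_le_dyadicInd (D.measurable_dyadicRight i) hB h1

/-- Each factor lives on an interval of length 2⁻⁽ⁿ⁺¹⁾ and so gains the square root of that length
in L²; the modulus of V supplies θⁿ. -/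
theorem norm_mul_norm_le (i : DyadicIdx) :
    ‖(D.memLp_left i).toLp _‖ * ‖(D.memLp_right i).toLp _‖
      ≤ M ^ 2 * C * θ ^ i.1 * (1 / 2) ^ (i.1 + 1) := by
  obtain ⟨A, B, k, k', h1, h2, hA, hB, hAB⟩ := D.exists_bounds i
  have h3 := norm_sq_toLp_le (D.memLp_left i) h1
  have h4 := norm_sq_toLp_le (D.memLp_right i) h2
  rw [← hAB]
  refine (abs_le_of_sq_le_sq' ?_ (by positivity)).2
  calc _ = ‖(D.memLp_left i).toLp _‖ ^ 2 * ‖(D.memLp_right i).toLp _‖ ^ 2 := by ring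
    _ ≤ (A ^ 2 * (1 / 2) ^ (i.1 + 1)) * (B ^ 2 * (1 / 2) ^ (i.1 + 1)) :=
        mul_le_mul h3 h4 (by positivity) (by positivity)
    _ = _ := by ring

theorem summable_norm_mul_norm :
    Summable fun i => ‖(D.memLp_left i).toLp _‖ * ‖(D.memLp_right i).toLp _‖ := by
  rw [summable_sigma_of_nonneg fun i => by positivity]
  refine ⟨fun n => (hasSum_fintype _).summable, ?_⟩
  -- There are 3·2ⁿ indices in generation n, each weighing at most M² C θⁿ 2⁻⁽ⁿ⁺¹⁾.
  have hg : Summable fun n : ℕ => (3 / 2 * (M ^ 2 * C)) * θ ^ n :=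
    (summable_geometric_of_lt_one D.θ_nonneg D.θ_lt_one).mul_left _
  refine Summable.of_nonneg_of_le (fun n => tsum_nonneg fun j => by positivity) (fun n => ?_) hg
  rw [tsum_fintype]
  refine (Finset.sum_le_sum fun j _ => D.norm_mul_norm_le ⟨n, j⟩).trans (le_of_eq ?_)
  dsimp only
  rw [Finset.sum_const, Finset.card_univ, Fintype.card_prod, Fintype.card_fin, Fintype.card_fin,
    nsmul_eq_mul, pow_succ, one_div, inv_pow]
  push_cast
  field_simp
  ring

theorem tail_tendsto (c : ℝ) : Tendsto (fun N => C * θ ^ N * c) atTop (𝓝 0) := by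
  have := ((tendsto_pow_atTop_nhds_zero_of_lt_one D.θ_nonneg D.θ_lt_one).const_mul C).mul_const c
  simpa using this

theorem memLp_f : MemLp f 2 μ₀ := memLp_of_continuousOn D.continuous_f.continuousOn

theorem abs_error_le (N : ℕ) {t s : ℝ} (ht : t ∈ Ico (0 : ℝ) 1) (hs : s ∈ Ico (0 : ℝ) 1) :
    |∑ i ∈ dyadicLevels N, dyadicRight V f i t * dyadicLeft V f i s
      - (V (max t s) * f t * f s - V 0 * f t * f s)| ≤ C * θ ^ N * M ^ 2 := by
  rw [sum_dyadicLevels V f N ht hs]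
  have : (V (max t s) - V 0 - remainder V N t s) * (f t * f s)
      - (V (max t s) * f t * f s - V 0 * f t * f s) = -(remainder V N t s * (f t * f s)) := by ring
  rw [this, abs_neg, abs_mul, abs_mul, sq]
  have hM := D.M_nonneg
  have hT := D.tail_nonneg N
  have := D.abs_remainder_le N ⟨ht.1, ht.2.le⟩ ⟨hs.1, hs.2.le⟩
  have h1 := D.bound_f t
  have h2 := D.bound_f s
  gcongr

/-- The kernel of the N-th partial sum misses its limit by at most C θᴺ M² almost everywhere, which
bounds the error in L². The telescoping leaves out the rank one kernel V(0) f(t) f(s). -/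
theorem tendsto_sum_apply {B : ℝ} (hk : BoundedKernel (fun t s => V (max t s) * f t * f s) B)
    (x : L2Unit) : Tendsto (fun N => ∑ i ∈ dyadicLevels N,
      inner ℝ ((D.memLp_left i).toLp _) x • (D.memLp_right i).toLp _) atTop
      (𝓝 (hk.op x - V 0 • inner ℝ (D.memLp_f.toLp f) x • D.memLp_f.toLp f)) := by
  rw [tendsto_iff_norm_sub_tendsto_zero]
  refine squeeze_zero (fun _ => norm_nonneg _) (fun N => ?_) (D.tail_tendsto (M ^ 2 * ‖x‖))
  have hfx : Integrable (fun s => f s * x s) μ₀ :=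
    integrable_continuousOn_mul D.continuous_f.continuousOn (integrable_coe x)
  have hLx : ∀ i, Integrable (fun s => dyadicLeft V f i s * x s) μ₀ := fun i =>
    (D.memLp_left i).integrable_mul (Lp.memLp x)
  have hb := mul_nonneg (mul_nonneg (D.tail_nonneg N) (sq_nonneg M)) (norm_nonneg x)
  rw [← mul_assoc]
  refine (Lp.norm_le_of_ae_bound hb ?_).trans (le_of_eq (by simp [measureUnivNNReal]))
  filter_upwards [ae_mem_Ico, hk.coeFn_op x, D.memLp_f.coeFn_toLp,
    coeFn_sum_smul_toLp (dyadicLevels N)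
      (fun i => inner ℝ ((D.memLp_left i).toLp _) x) D.memLp_right,
    Lp.coeFn_sub (∑ i ∈ dyadicLevels N, inner ℝ ((D.memLp_left i).toLp _) x •
      (D.memLp_right i).toLp _)
      (hk.op x - V 0 • inner ℝ (D.memLp_f.toLp f) x • D.memLp_f.toLp f),
    Lp.coeFn_sub (hk.op x) (V 0 • inner ℝ (D.memLp_f.toLp f) x • D.memLp_f.toLp f),
    Lp.coeFn_smul (V 0) (inner ℝ (D.memLp_f.toLp f) x • D.memLp_f.toLp f),
    Lp.coeFn_smul (inner ℝ (D.memLp_f.toLp f) x) (D.memLp_f.toLp f)]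
    with t ht h1 h2 h3 h4 h5 h6 h7
  rw [h4, Pi.sub_apply, h3, h5, Pi.sub_apply, h1, h6, Pi.smul_apply, h7, Pi.smul_apply, h2]
  have key : ∑ i ∈ dyadicLevels N, inner ℝ ((D.memLp_left i).toLp _) x * dyadicRight V f i t
      - (∫ s, V (max t s) * f t * f s * x s ∂μ₀
        - V 0 • inner ℝ (D.memLp_f.toLp f) x • f t)
      = ∫ s, (∑ i ∈ dyadicLevels N, dyadicRight V f i t * dyadicLeft V f i s
      - (V (max t s) * f t * f s - V 0 * f t * f s)) * x s ∂μ₀ := by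
    have e1 : ∀ s, (∑ i ∈ dyadicLevels N, dyadicRight V f i t * dyadicLeft V f i s
      - (V (max t s) * f t * f s - V 0 * f t * f s)) * x s =
      ∑ i ∈ dyadicLevels N, dyadicRight V f i t * (dyadicLeft V f i s * x s)
      - (V (max t s) * f t * f s * x s - V 0 * f t * (f s * x s)) := by
      intro s
      rw [sub_mul, Finset.sum_mul]
      simp only [mul_assoc, sub_mul]
    simp only [e1]
    rw [integral_sub, integral_finsetSum, integral_sub, integral_const_mul]
    · congr 1
      · refine Finset.sum_congr rfl fun i _ => ?_
        rw [integral_const_mul, inner_toLp, mul_comm]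
      · rw [inner_toLp, smul_eq_mul, smul_eq_mul]
        ring
    · exact hk.integrable_slice_mul x t
    · exact hfx.const_mul _
    · exact fun i _ => (hLx i).const_mul _
    · exact integrable_finsetSum _ fun i _ => (hLx i).const_mul _
    · exact (hk.integrable_slice_mul x t).sub (hfx.const_mul _)
  rw [key, Real.norm_eq_abs]
  refine abs_integral_mul_le ?_ (mul_nonneg (D.tail_nonneg N) (sq_nonneg M)) ?_ x
  · refine AEStronglyMeasurable.sub ?_ ?_
    · exact (Finset.measurable_fun_sum _ fun i _ =>
        (D.measurable_dyadicLeft i).const_mul _).aestronglyMeasurable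
    · have hV := D.continuous_V
      have hf := D.continuous_f
      exact Continuous.aestronglyMeasurable (by fun_prop)
  · filter_upwards [ae_mem_Ico] with s hs using D.abs_error_le N ht hs

/-- The same pointwise error bound read at s = t. The identity is pointwise, so restricting it to
the diagonal is legitimate. -/
theorem tendsto_sum_trace : Tendsto (fun N => ∑ i ∈ dyadicLevels N,
      inner ℝ ((D.memLp_left i).toLp (dyadicLeft V f i))
        ((D.memLp_right i).toLp (dyadicRight V f i))) atTop
      (𝓝 (∫ t, (V t * f t * f t - V 0 * f t * f t) ∂μ₀)) := by
  rw [tendsto_iff_norm_sub_tendsto_zero]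
  refine squeeze_zero (fun _ => norm_nonneg _) (fun N => ?_) (D.tail_tendsto (M ^ 2))
  have hLR : ∀ i, Integrable (fun t => dyadicRight V f i t * dyadicLeft V f i t) μ₀ := fun i =>
    (D.memLp_right i).integrable_mul (D.memLp_left i)
  have hV := D.continuous_V
  have hf := D.continuous_f
  have hi : Integrable (fun t => V t * f t * f t - V 0 * f t * f t) μ₀ :=
    integrable_of_continuousOn (Continuous.continuousOn (by fun_prop))
  have e1 : ∑ i ∈ dyadicLevels N, inner ℝ ((D.memLp_left i).toLp (dyadicLeft V f i))
        ((D.memLp_right i).toLp (dyadicRight V f i)) =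
      ∫ t, ∑ i ∈ dyadicLevels N, dyadicRight V f i t * dyadicLeft V f i t ∂μ₀ := by
    rw [integral_finsetSum _ fun i _ => hLR i]
    refine Finset.sum_congr rfl fun i _ => ?_
    rw [inner_toLp]
    refine integral_congr_ae ?_
    filter_upwards [(D.memLp_right i).coeFn_toLp] with t ht
    rw [ht, mul_comm]
  rw [e1, ← integral_sub (integrable_finsetSum _ fun i _ => hLR i) hi]
  refine (norm_integral_le_of_norm_le_const (C := C * θ ^ N * M ^ 2) ?_).trans
    (le_of_eq (by simp))
  filter_upwards [ae_mem_Ico] with t ht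
  simpa using D.abs_error_le N ht ht

/-- An integral operator with kernel `V(t ∨ s) f(t) f(s)`, where `V` is Hölder continuous, is
nuclear with trace `∫ V f²`. -/
theorem isNuclearWithTrace_op {B : ℝ}
    (hk : BoundedKernel (fun t s => V (max t s) * f t * f s) B) :
    IsNuclearWithTrace hk.op (∫ t, V t * f t ^ 2 ∂μ₀) := by
  set e := D.memLp_f.toLp f
  -- The rank one part V(0) f ⊗ f is removed here and added back in `h2`.
  have h1 : IsNuclearWithTrace (hk.op - (innerSL ℝ (V 0 • e)).smulRight e)
      (∫ t, (V t * f t * f t - V 0 * f t * f t) ∂μ₀) := by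
    refine IsNuclearWithTrace.of_exhaustion D.summable_norm_mul_norm tendsto_dyadicLevels
      (fun x => ?_) D.tendsto_sum_trace
    convert! D.tendsto_sum_apply hk x using 2
    simp [e, smul_smul]
  have h2 := h1.add (IsNuclearWithTrace.rankOne (V 0 • e) e)
  rw [sub_add_cancel] at h2
  have hV := D.continuous_V
  have hf := D.continuous_f
  convert h2 using 1
  have h3 : inner ℝ (V 0 • e) e = ∫ t, V 0 * f t * f t ∂μ₀ := by
    rw [real_inner_smul_left, inner_toLp, ← integral_const_mul]
    refine integral_congr_ae ?_
    filter_upwards [D.memLp_f.coeFn_toLp] with t ht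
    rw [ht, mul_assoc]
  rw [h3, ← integral_add]
  · exact integral_congr_ae (Eventually.of_forall fun t => by ring)
  · exact integrable_of_continuousOn (Continuous.continuousOn (by fun_prop))
  · exact integrable_of_continuousOn (Continuous.continuousOn (by fun_prop))

end DyadicData

/-! ### Dyadic moduli of continuity -/

/-- The dyadic modulus of continuity on `[0,1]` decays geometrically. -/
def HasDyadicModulus (V : ℝ → ℝ) : Prop :=
  ∃ C θ : ℝ, 0 ≤ C ∧ 0 ≤ θ ∧ θ < 1 ∧ ∀ n : ℕ, ∀ s ∈ Icc (0 : ℝ) 1, ∀ t ∈ Icc (0 : ℝ) 1,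
    |s - t| ≤ (1 / 2) ^ n → |V s - V t| ≤ C * θ ^ n

theorem IsHolder.continuousOn {a : ℝ → ℝ} (ha : IsHolder a) : ContinuousOn a (Icc 0 1) := by
  obtain ⟨C, δ, hδ, h⟩ := ha
  exact h.continuousOn hδ

/-- The ratio is θ = 2^(-δ). The dyadic form is stable under sums, products and inverses by taking
the larger ratio. -/
theorem IsHolder.hasDyadicModulus {a : ℝ → ℝ} (ha : IsHolder a) : HasDyadicModulus a := by
  obtain ⟨C, δ, hδ, h⟩ := ha
  refine ⟨C, (1 / 2) ^ (δ : ℝ), C.2, by positivity,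
    Real.rpow_lt_one (by norm_num) (by norm_num) (by exact_mod_cast hδ), fun n s hs t ht hst => ?_⟩
  have h1 : dist (a s) (a t) ≤ C * dist s t ^ (δ : ℝ) :=
    (HolderWith.restrict_iff.2 h).dist_le ⟨s, hs⟩ ⟨t, ht⟩
  rw [Real.dist_eq, Real.dist_eq] at h1
  refine h1.trans (mul_le_mul_of_nonneg_left ?_ C.2)
  rw [← Real.rpow_natCast, ← Real.rpow_mul (by norm_num), mul_comm, Real.rpow_mul (by norm_num),
    Real.rpow_natCast]
  exact Real.rpow_le_rpow (abs_nonneg _) hst δ.2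

namespace HasDyadicModulus

variable {V W : ℝ → ℝ}

theorem of_contDiff (hV : ContDiff ℝ 1 V) : HasDyadicModulus V := by
  obtain ⟨K, hK⟩ := hV.contDiffOn.exists_lipschitzOnWith one_ne_zero (convex_Icc (0 : ℝ) 1)
    isCompact_Icc
  refine ⟨K, 1 / 2, K.2, by norm_num, by norm_num, fun n s hs t ht hst => ?_⟩
  have := hK.dist_le_mul s hs t ht
  rw [Real.dist_eq, Real.dist_eq] at this
  exact this.trans (mul_le_mul_of_nonneg_left hst K.2)

theorem congr (hV : HasDyadicModulus V) (h : ∀ t ∈ Icc (0 : ℝ) 1, W t = V t) :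
    HasDyadicModulus W := by
  obtain ⟨C, θ, hC, h0, h1, hm⟩ := hV
  refine ⟨C, θ, hC, h0, h1, fun n s hs t ht hst => ?_⟩
  rw [h s hs, h t ht]
  exact hm n s hs t ht hst

/-- A combination of moduli of continuity. -/
theorem of_le_add (hV : HasDyadicModulus V) (hW : HasDyadicModulus W) {U : ℝ → ℝ} {A B : ℝ}
    (hA : 0 ≤ A) (hB : 0 ≤ B) (h : ∀ s ∈ Icc (0 : ℝ) 1, ∀ t ∈ Icc (0 : ℝ) 1,
      |U s - U t| ≤ A * |V s - V t| + B * |W s - W t|) : HasDyadicModulus U := by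
  obtain ⟨C, θ, hC, h0, h1, hm⟩ := hV
  obtain ⟨C', θ', hC', h0', h1', hm'⟩ := hW
  refine ⟨A * C + B * C', max θ θ', by positivity, le_max_of_le_left h0, max_lt h1 h1',
    fun n s hs t ht hst => (h s hs t ht).trans ?_⟩
  have e1 : θ ^ n ≤ max θ θ' ^ n := pow_le_pow_left₀ h0 (le_max_left _ _) n
  have e2 : θ' ^ n ≤ max θ θ' ^ n := pow_le_pow_left₀ h0' (le_max_right _ _) n
  calc A * |V s - V t| + B * |W s - W t| ≤ A * (C * max θ θ' ^ n) + B * (C' * max θ θ' ^ n) := by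
        refine add_le_add (mul_le_mul_of_nonneg_left ?_ hA) (mul_le_mul_of_nonneg_left ?_ hB)
        · exact (hm n s hs t ht hst).trans (mul_le_mul_of_nonneg_left e1 hC)
        · exact (hm' n s hs t ht hst).trans (mul_le_mul_of_nonneg_left e2 hC')
    _ = _ := by ring

theorem add (hV : HasDyadicModulus V) (hW : HasDyadicModulus W) :
    HasDyadicModulus (fun t => V t + W t) :=
  hV.of_le_add hW zero_le_one zero_le_one fun s _ t _ => by
    rw [one_mul, one_mul, add_sub_add_comm]
    exact abs_add_le _ _

theorem sub (hV : HasDyadicModulus V) (hW : HasDyadicModulus W) :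
    HasDyadicModulus (fun t => V t - W t) :=
  hV.of_le_add hW zero_le_one zero_le_one fun s _ t _ => by
    rw [one_mul, one_mul, sub_sub_sub_comm]
    exact abs_sub _ _

theorem mul (hV : HasDyadicModulus V) (hW : HasDyadicModulus W)
    (cV : ContinuousOn V (Icc 0 1)) (cW : ContinuousOn W (Icc 0 1)) :
    HasDyadicModulus (fun t => V t * W t) := by
  obtain ⟨A, hA0, hA⟩ := exists_bound_of_continuousOn cV
  obtain ⟨B, hB0, hB⟩ := exists_bound_of_continuousOn cW
  refine hV.of_le_add hW hB0 hA0 fun s hs t ht => ?_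
  have : V s * W s - V t * W t = W s * (V s - V t) + V t * (W s - W t) := by ring
  rw [this]
  refine (abs_add_le _ _).trans ?_
  rw [abs_mul, abs_mul]
  exact add_le_add (mul_le_mul_of_nonneg_right (hB s hs) (abs_nonneg _))
    (mul_le_mul_of_nonneg_right (hA t ht) (abs_nonneg _))

theorem inv (hV : HasDyadicModulus V) (cV : ContinuousOn V (Icc 0 1))
    (pV : ∀ t ∈ Icc (0 : ℝ) 1, 0 < V t) : HasDyadicModulus (fun t => (V t)⁻¹) := by
  obtain ⟨B, hB0, hB⟩ := exists_bound_of_continuousOn (cV.inv₀ fun t ht => (pV t ht).ne')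
  refine hV.of_le_add hV (mul_nonneg hB0 hB0) le_rfl fun s hs t ht => ?_
  have : (V s)⁻¹ - (V t)⁻¹ = (V s)⁻¹ * (V t)⁻¹ * (V t - V s) := by
    have := (pV s hs).ne'
    have := (pV t ht).ne'
    field_simp
  rw [this, abs_mul, abs_mul, abs_sub_comm, zero_mul, add_zero]
  exact mul_le_mul_of_nonneg_right
    (mul_le_mul (hB s hs) (hB t ht) (abs_nonneg _) hB0) (abs_nonneg _)

end HasDyadicModulus

/-! ### Extensions from the unit interval -/

/-- The continuous extension of a function on `[0,1]` which is constant outside. -/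
noncomputable def extend (q : ℝ → ℝ) : ℝ → ℝ :=
  IccExtend zero_le_one ((Icc (0 : ℝ) 1).domRestrict q)

theorem extend_of_mem (q : ℝ → ℝ) {t : ℝ} (ht : t ∈ Icc (0 : ℝ) 1) : extend q t = q t := by
  rw [extend, IccExtend_of_mem _ _ ht]
  rfl

theorem continuous_extend {q : ℝ → ℝ} (hq : ContinuousOn q (Icc 0 1)) : Continuous (extend q) :=
  continuous_IccExtend_iff.2 (continuousOn_iff_continuous_domRestrict.1 hq)

theorem exists_bound_extend {q : ℝ → ℝ} (hq : ContinuousOn q (Icc 0 1)) :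
    ∃ C, ∀ t, |extend q t| ≤ C := by
  obtain ⟨C, -, hC⟩ := exists_bound_of_continuousOn hq
  exact ⟨C, fun t => hC _ (projIcc 0 1 zero_le_one t).2⟩

/-- The data are controlled on [0,1] only, while bounded kernels and `DyadicData` ask for global
bounds and continuity. -/
theorem exists_extension {q : ℝ → ℝ} (hq : ContinuousOn q (Icc 0 1)) :
    ∃ Q : ℝ → ℝ, Continuous Q ∧ (∃ C, ∀ t, |Q t| ≤ C) ∧ ∀ t ∈ Icc (0 : ℝ) 1, Q t = q t :=
  ⟨extend q, continuous_extend hq, exists_bound_extend hq, fun _ => extend_of_mem q⟩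

/-- The primitive of a continuous function on `[0,1]` has a `C¹` extension. -/
theorem exists_contDiff_primitive {q : ℝ → ℝ} (hq : ContinuousOn q (Icc 0 1)) :
    ∃ Q : ℝ → ℝ, ContDiff ℝ 1 Q ∧ (∀ t ∈ Icc (0 : ℝ) 1, Q t = ∫ s in (0 : ℝ)..t, q s) ∧
      ∀ t ∈ Icc (0 : ℝ) 1, HasDerivAt Q (q t) t := by
  have hc := continuous_extend hq
  have hd : ∀ t, HasDerivAt (fun t => ∫ s in (0 : ℝ)..t, extend q s) (extend q t) t := fun t =>
    intervalIntegral.integral_hasDerivAt_right (hc.intervalIntegrable _ _)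
      hc.aestronglyMeasurable.stronglyMeasurableAtFilter hc.continuousAt
  refine ⟨fun t => ∫ s in (0 : ℝ)..t, extend q s, ?_, fun t ht => ?_, fun t ht => ?_⟩
  · rw [contDiff_one_iff_deriv]
    refine ⟨fun t => (hd t).differentiableAt, ?_⟩
    rwa [funext fun t => (hd t).deriv]
  · refine intervalIntegral.integral_congr fun s hs => extend_of_mem q ?_
    rw [uIcc_of_le ht.1] at hs
    exact ⟨hs.1, hs.2.trans ht.2⟩
  · have := hd t
    rwa [extend_of_mem q ht] at this

namespace Regular

variable {Γ a : ℝ → ℝ} (H : Regular Γ a)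
include H

theorem hasDyadicModulus_f (hΓ : HasDyadicModulus fun t => √(Γ t)) :
    HasDyadicModulus (f Γ a) := by
  obtain ⟨Q, hQ, hQ', -⟩ := exists_contDiff_primitive H.drift
  refine hΓ.mul ((HasDyadicModulus.of_contDiff hQ.neg.exp).congr fun t ht => ?_) H.sqrt
    (Real.continuous_exp.comp_continuousOn H.continuousOn_primitive.neg)
  rw [hQ' t ht]

end Regular

/-! ### Volterra operators -/

section Volterra

variable {w F : ℝ → ℝ}

theorem boundedKernel_volterra (hw : Continuous w) (hF : Continuous F) {A B : ℝ}
    (hA : ∀ t, |w t| ≤ A) (hB : ∀ t, |F t| ≤ B) :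
    BoundedKernel (fun t s => if s ≤ t then w t * F s else 0) (A * B) := by
  have hA0 : 0 ≤ A := (abs_nonneg _).trans (hA 0)
  have hB0 : 0 ≤ B := (abs_nonneg _).trans (hB 0)
  refine ⟨?_, fun t s => ?_⟩
  · refine Measurable.ite (measurableSet_le measurable_snd measurable_fst) ?_ measurable_const
    exact Continuous.measurable (by fun_prop)
  · split_ifs
    · rw [abs_mul]; exact mul_le_mul (hA t) (hB s) (abs_nonneg _) hA0
    · simpa using mul_nonneg hA0 hB0

variable {A : ℝ} (hk : BoundedKernel (fun t s => if s ≤ t then w t * F s else 0) A)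

theorem coeFn_volterra_op (x : L2Unit) :
    hk.op x =ᵐ[μ₀] fun t => w t * ∫ s in (0 : ℝ)..t, F s * x s := by
  filter_upwards [hk.coeFn_op x, ae_restrict_mem measurableSet_Icc] with t h ht
  rw [h, ← intervalIntegral.integral_const_mul, ← integral_indicator_Iic ht.1 ht.2]
  refine integral_congr_ae (Eventually.of_forall fun s => ?_)
  simp only [indicator, mem_Iic]
  split_ifs <;> ring

theorem integral_indicator_Ici (z : ℝ → ℝ) {t : ℝ} (ht : t ∈ Icc (0 : ℝ) 1) :
    ∫ s, (Ici t).indicator z s ∂μ₀ = ∫ s in t..1, z s := by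
  rw [integral_indicator measurableSet_Ici, Measure.restrict_restrict measurableSet_Ici,
    intervalIntegral.integral_of_le ht.2, ← integral_Icc_eq_integral_Ioc]
  congr 2
  ext s
  have := ht.1
  simp only [mem_inter_iff, mem_Ici, mem_Icc]
  grind

/-- `K + Kᵀ + Kᵀ K` for a Volterra operator `K`. -/
theorem volterra_add_adjoint {V : ℝ → ℝ} {B : ℝ}
    (hR : BoundedKernel (fun t s => V (max t s) * F t * F s) B)
    (hV : ∀ t ∈ Icc (0 : ℝ) 1, V t * F t = w t + (∫ u in t..1, w u ^ 2) * F t) :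
    hk.op + ContinuousLinearMap.adjoint hk.op + ContinuousLinearMap.adjoint hk.op ∘L hk.op
      = hR.op := by
  rw [hk.adjoint_op, hk.transpose.op_comp hk, ← hk.op_add hk.transpose,
    ← (hk.add hk.transpose).op_add (hk.transpose.comp hk)]
  refine BoundedKernel.op_congr _ _ fun t ht => ?_
  have hne : ∀ᵐ s ∂μ₀, s ≠ t := ae_restrict_of_ae (by simp [ae_iff, measure_singleton])
  filter_upwards [ae_restrict_mem measurableSet_Icc, hne] with s hs hst
  have hm : max t s ∈ Icc (0 : ℝ) 1 := ⟨ht.1.trans (le_max_left _ _), max_le ht.2 hs.2⟩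
  -- The kernel of KᵀK: both constraints together say u ≥ t ∨ s.
  have e1 : ∫ u, (if t ≤ u then w u * F t else 0) * (if s ≤ u then w u * F s else 0) ∂μ₀
      = F t * F s * ∫ u in (max t s)..1, w u ^ 2 := by
    rw [← integral_indicator_Ici _ hm, ← integral_const_mul]
    refine integral_congr_ae (Eventually.of_forall fun u => ?_)
    simp only [indicator, mem_Ici, max_le_iff]
    split_ifs <;> grind
  rw [e1]
  -- Off the diagonal exactly one of K and Kᵀ is present, and `hV` at the larger coordinate, times F
  -- at the smaller one, is the claim.
  rcases lt_or_gt_of_ne hst with h | h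
  · rw [if_pos h.le, if_neg (not_le.2 h), max_eq_left h.le]
    linear_combination -F s * hV t ht
  · rw [if_pos h.le, if_neg (not_le.2 h), max_eq_right h.le]
    linear_combination -F t * hV s hs

end Volterra

/-! ### Change of drift -/

theorem g_eq_exp_mul {α β : ℝ → ℝ} (hα : ContinuousOn α (Icc 0 1)) (hβ : ContinuousOn β (Icc 0 1))
    {t : ℝ} (ht : t ∈ Icc (0 : ℝ) 1) :
    g α t = Real.exp (∫ v in (0 : ℝ)..t, (α v - β v)) * g β t := by
  rw [g, g, ← Real.exp_add, intervalIntegral.integral_sub, sub_add_cancel]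
  · exact intervalIntegrable_of_integrable (integrable_of_continuousOn hα) (by simp) ht
  · exact intervalIntegrable_of_integrable (integrable_of_continuousOn hβ) (by simp) ht

theorem f_eq_exp_mul {α β : ℝ → ℝ} (Γ : ℝ → ℝ) (hα : ContinuousOn α (Icc 0 1))
    (hβ : ContinuousOn β (Icc 0 1)) {t : ℝ} (ht : t ∈ Icc (0 : ℝ) 1) :
    f Γ β t = Real.exp (∫ v in (0 : ℝ)..t, (α v - β v)) * f Γ α t := by
  rw [f, f, mul_left_comm, ← Real.exp_add, intervalIntegral.integral_sub]
  · congr 2; ring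
  · exact intervalIntegrable_of_integrable (integrable_of_continuousOn hα) (by simp) ht
  · exact intervalIntegrable_of_integrable (integrable_of_continuousOn hβ) (by simp) ht

/-- Integration by parts against the exponential of a primitive. -/
theorem exp_primitive_mul_primitive {d q : ℝ → ℝ} (hd : ContinuousOn d (Icc 0 1))
    (hq : Integrable q μ₀) {t : ℝ} (ht : t ∈ Icc (0 : ℝ) 1) :
    ∫ s in (0 : ℝ)..t, Real.exp (∫ v in (0 : ℝ)..s, d v) *
        (d s * (∫ u in (0 : ℝ)..s, q u) + q s)
      = Real.exp (∫ v in (0 : ℝ)..t, d v) * ∫ u in (0 : ℝ)..t, q u := by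
  obtain ⟨Q, hQ, hQ1, hQ2⟩ := exists_contDiff_primitive hd
  have hi : IntervalIntegrable q volume 0 t := intervalIntegrable_of_integrable hq (by simp) ht
  -- As q is merely integrable, its primitive is differentiable only almost everywhere; absolute
  -- continuity is what justifies integrating the product rule.
  have hJ : AbsolutelyContinuousOnInterval (fun s => ∫ u in (0 : ℝ)..s, q u) 0 t :=
    hi.absolutelyContinuousOnInterval_intervalIntegral (by simp)
  have hP : AbsolutelyContinuousOnInterval (fun s => Real.exp (Q s)) 0 t :=
    (hQ.exp.contDiffOn).absolutelyContinuousOnInterval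
  have key := hP.integral_deriv_mul_eq_sub hJ
  rw [intervalIntegral.integral_same, mul_zero, sub_zero, hQ1 t ht] at key
  rw [← key]
  refine intervalIntegral.integral_congr_ae ?_
  filter_upwards [hi.ae_hasDerivAt_integral] with s h1 hs
  have hs' : s ∈ uIcc 0 t := uIoc_subset_uIcc hs
  have hs1 : s ∈ Icc (0 : ℝ) 1 := uIcc_subset_Icc (by simp) ht hs'
  rw [(h1 hs' 0 (by simp)).deriv, (hQ2 s hs1).exp.deriv, hQ1 s hs1]
  ring

/-- The function `V` such that `R(t,s) = V(t ∨ s) f(t) f(s)`. -/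
noncomputable def kernelProfile (Γ α β : ℝ → ℝ) (t : ℝ) : ℝ :=
  (α t - β t) * ((f Γ α t)⁻¹ * (f Γ α t)⁻¹) + ∫ u in t..1, (α u - β u) ^ 2 / f Γ α u ^ 2

theorem kernel_eq {Γ α : ℝ → ℝ} (Hα : Regular Γ α) (β : ℝ → ℝ) {t s : ℝ} (ht : t ∈ Icc (0 : ℝ) 1) (hs : s ∈ Icc (0 : ℝ) 1) :
    kernel Γ α β t s = kernelProfile Γ α β (max t s) * f Γ α t * f Γ α s := by
  have h1 := (Hα.f_pos ht).ne'
  have h2 := (Hα.f_pos hs).ne'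
  rw [kernel, kernelProfile]
  rcases le_total t s with h | h
  · rw [max_eq_right h, min_eq_left h]; field_simp
  · rw [max_eq_left h, min_eq_right h]; field_simp

section Comparison

variable {Γ α β : ℝ → ℝ} (Hα : Regular Γ α) (Hβ : Regular Γ β)
include Hα Hβ

theorem continuousOn_drift_div :
    ContinuousOn (fun t => (α t - β t) / f Γ α t) (Icc 0 1) :=
  (Hα.drift.sub Hβ.drift).div Hα.continuousOn_f fun _ ht => (Hα.f_pos ht).ne'

/-- The path driven by `x` under the drift `α`, seen under the drift `β`, is driven by
`x + K x`. -/
theorem g_mul_primitive_eq {x z : L2Unit} (hz : z =ᵐ[μ₀] fun t =>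
      x t + (α t - β t) / f Γ α t * ∫ s in (0 : ℝ)..t, f Γ α s * x s)
    {t : ℝ} (ht : t ∈ Icc (0 : ℝ) 1) :
    g β t * ∫ s in (0 : ℝ)..t, f Γ β s * z s = g α t * ∫ s in (0 : ℝ)..t, f Γ α s * x s := by
  -- With E = exp ∫₀(α - β) and J = ∫₀ f_α x, the integrand f_β z is E ((α - β) J + f_α x), the
  -- derivative of E J; and g_β E = g_α.
  have h1 := exp_primitive_mul_primitive (d := fun s => α s - β s) (Hα.drift.sub Hβ.drift)
    (integrable_continuousOn_mul Hα.continuousOn_f (integrable_coe x)) ht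
  rw [g_eq_exp_mul Hα.drift Hβ.drift ht, mul_right_comm, ← h1, mul_comm,
    intervalIntegral_congr_of_ae hz _ (by simp) ht]
  congr 1
  refine intervalIntegral.integral_congr fun s hs => ?_
  have hs1 : s ∈ Icc (0 : ℝ) 1 := uIcc_subset_Icc (by simp) ht hs
  have := (Hα.f_pos hs1).ne'
  rw [f_eq_exp_mul Γ Hα.drift Hβ.drift hs1]
  field_simp
  ring

theorem exists_profile_tail : ∃ Q : ℝ → ℝ, ContDiff ℝ 1 Q ∧
    (∀ t ∈ Icc (0 : ℝ) 1, ∫ u in t..1, (α u - β u) ^ 2 / f Γ α u ^ 2 = Q 1 - Q t) ∧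
    ∀ t ∈ Icc (0 : ℝ) 1, HasDerivAt Q ((α t - β t) ^ 2 / f Γ α t ^ 2) t := by
  have hc : ContinuousOn (fun u => (α u - β u) ^ 2 / f Γ α u ^ 2) (Icc 0 1) :=
    ((Hα.drift.sub Hβ.drift).pow 2).div (Hα.continuousOn_f.pow 2)
      fun t ht => pow_ne_zero 2 (Hα.f_pos ht).ne'
  obtain ⟨Q, h1, h2, h3⟩ := exists_contDiff_primitive hc
  refine ⟨Q, h1, fun t ht => ?_, h3⟩
  rw [h2 t ht, h2 1 (by simp), integral_sub_integral (integrable_of_continuousOn hc) ht (by simp)]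

theorem continuousOn_kernelProfile : ContinuousOn (kernelProfile Γ α β) (Icc 0 1) := by
  obtain ⟨Q, h1, h2, -⟩ := exists_profile_tail Hα Hβ
  have hf : ContinuousOn (fun t => (f Γ α t)⁻¹) (Icc 0 1) :=
    Hα.continuousOn_f.inv₀ fun t ht => (Hα.f_pos ht).ne'
  refine ((Hα.drift.sub Hβ.drift).mul (hf.mul hf)).add ?_
  exact (continuousOn_const.sub h1.continuous.continuousOn).congr h2

theorem hasDyadicModulus_kernelProfile (hα : HasDyadicModulus α) (hβ : HasDyadicModulus β)
    (hΓ : HasDyadicModulus fun t => √(Γ t)) : HasDyadicModulus (kernelProfile Γ α β) := by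
  obtain ⟨Q, h1, h2, -⟩ := exists_profile_tail Hα Hβ
  have hf : ContinuousOn (fun t => (f Γ α t)⁻¹) (Icc 0 1) :=
    Hα.continuousOn_f.inv₀ fun t ht => (Hα.f_pos ht).ne'
  have mf := (Hα.hasDyadicModulus_f hΓ).inv Hα.continuousOn_f fun t ht => Hα.f_pos ht
  refine ((hα.sub hβ).mul (mf.mul mf hf hf) (Hα.drift.sub Hβ.drift) (hf.mul hf)).add ?_
  exact (HasDyadicModulus.of_contDiff (contDiff_const.sub h1)).congr h2

/-- In V f² the first term of V gives α - β. The tail term is integrated by parts against f² = h';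
the boundary terms vanish because the tail is zero at 1 and h is zero at 0. -/
theorem integral_kernelProfile :
    ∫ t in (0 : ℝ)..1, kernelProfile Γ α β t * f Γ α t ^ 2
      = (∫ t in (0 : ℝ)..1, (α t - β t))
          + ∫ t in (0 : ℝ)..1, h Γ α t / f Γ α t ^ 2 * (α t - β t) ^ 2 := by
  obtain ⟨Q, hQ1, hQ2, hQ3⟩ := exists_profile_tail Hα Hβ
  obtain ⟨S, hS1, hS2, hS3⟩ := exists_contDiff_primitive (Hα.continuousOn_f.pow 2)
  have hu : uIcc (0 : ℝ) 1 = Icc 0 1 := uIcc_of_le zero_le_one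
  have hdQ := (contDiff_one_iff_deriv.1 hQ1).2
  have hdS := (contDiff_one_iff_deriv.1 hS1).2
  have ibp := intervalIntegral.integral_mul_deriv_eq_deriv_mul (a := 0) (b := 1)
    (u := fun t => Q 1 - Q t) (u' := fun t => - deriv Q t) (v := S) (v' := deriv S)
    (fun t _ => ((hQ1.differentiable one_ne_zero t).hasDerivAt).const_sub _)
    (fun t _ => (hS1.differentiable one_ne_zero t).hasDerivAt)
    (hdQ.neg.intervalIntegrable _ _) (hdS.intervalIntegrable _ _)
  have hS0 : S 0 = 0 := by rw [hS2 0 (by simp)]; simp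
  rw [sub_self, zero_mul, hS0, mul_zero, sub_zero, zero_sub,
    ← intervalIntegral.integral_neg] at ibp
  have e1 : ∫ t in (0 : ℝ)..1, kernelProfile Γ α β t * f Γ α t ^ 2
      = ∫ t in (0 : ℝ)..1, ((α t - β t) + (Q 1 - Q t) * deriv S t) := by
    refine intervalIntegral.integral_congr fun t ht => ?_
    rw [hu] at ht
    have := (Hα.f_pos ht).ne'
    rw [kernelProfile, hQ2 t ht, (hS3 t ht).deriv]
    field_simp
    simp only [Pi.pow_apply]
    ring
  rw [e1, intervalIntegral.integral_add, ibp]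
  · congr 1
    refine intervalIntegral.integral_congr fun t ht => ?_
    rw [hu] at ht
    rw [(hQ3 t ht).deriv, hS2 t ht, h, hInc]
    simp only [Pi.pow_apply]
    ring
  · exact intervalIntegrable_of_integrable
      (integrable_of_continuousOn (Hα.drift.sub Hβ.drift)) (by simp) (by simp)
  · exact Continuous.intervalIntegrable
      (by have := hQ1.continuous; fun_prop) _ _

end Comparison

/-- A conjugate of `1 + K` between two Hilbert bases. -/
theorem adjoint_comp_sub_id {E F : Type} [NormedAddCommGroup E] [InnerProductSpace ℝ E]
    [CompleteSpace E] [NormedAddCommGroup F] [InnerProductSpace ℝ F] [CompleteSpace F]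
    (A B : F ≃ₗᵢ[ℝ] E) (K : E →L[ℝ] E) :
    ContinuousLinearMap.adjoint ((B.symm : E →L[ℝ] F) ∘L (ContinuousLinearMap.id ℝ E + K) ∘L
        (A : F →L[ℝ] E)) ∘L ((B.symm : E →L[ℝ] F) ∘L (ContinuousLinearMap.id ℝ E + K) ∘L
        (A : F →L[ℝ] E)) - ContinuousLinearMap.id ℝ F
      = (A.symm : E →L[ℝ] F) ∘L (K + ContinuousLinearMap.adjoint K
          + ContinuousLinearMap.adjoint K ∘L K) ∘L (A : F →L[ℝ] E) := by
  refine ContinuousLinearMap.ext fun x => ext_inner_left ℝ fun y => ?_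
  have hA : ∀ (u : E), inner ℝ y (A.symm u) = inner ℝ (A y) u := fun u => by
    rw [← A.inner_map_map, A.apply_symm_apply]
  simp only [ContinuousLinearMap.comp_apply, sub_apply, add_apply, inner_sub_right,
    ContinuousLinearMap.adjoint_inner_right, ContinuousLinearMap.id_apply, inner_add_right,
    LinearIsometryEquiv.coe_coe'', hA, LinearIsometryEquiv.inner_map_map, inner_add_left]
  rw [← A.inner_map_map y x]
  ring

end GaussMarkov

/-! ### Assembly -/

open GaussMarkov in
theorem mainTheorem10 (P : NestedPartition) (α β Γ : ℝ → ℝ)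
    (hα : IsHolder α) (hβ : IsHolder β)
    (hΓ : IsHolder (fun t => √(Γ t)))
    (hΓpos : ∀ t ∈ Set.Icc (0 : ℝ) 1, 0 < Γ t) :
    -- the series defining `Ψ_α(ξ)` converges uniformly on `[0,1]` for `ξ ∈ ℓ²`
    (∀ ξ : L2Seq, TendstoUniformlyOn
      (fun (F : Finset Idx) (t : ℝ) => ∑ i ∈ F, psi P Γ α i t * ξ i)
      (construction P Γ α ξ) Filter.atTop (Set.Icc (0 : ℝ) 1)) ∧
    -- `G = Δ_β ∘ Ψ_α` is a bounded operator of `ℓ²`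
    ∃ G : L2Seq →L[ℝ] L2Seq,
      (∀ (ξ : L2Seq) (i : Idx), G ξ i = coefficient P Γ β (construction P Γ α ξ) i) ∧
      -- with `S = Gᵀ G`, the operator `S - Id` is trace class, with the given trace
      IsTraceClass (ContinuousLinearMap.adjoint G ∘L G - ContinuousLinearMap.id ℝ L2Seq) ∧
      HasTrace (ContinuousLinearMap.adjoint G ∘L G - ContinuousLinearMap.id ℝ L2Seq)
        ((∫ t in (0 : ℝ)..1, (α t - β t))
          + ∫ t in (0 : ℝ)..1, h Γ α t / f Γ α t ^ 2 * (α t - β t) ^ 2) ∧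
      -- `Φ(ξ) = ∑ φ_{n,k} ξ_{n,k}` is an isometry of `ℓ²` onto `L²[0,1]` which carries `S - Id`
      -- to the integral operator with kernel `R(t,s)`
      ∃ Φ : L2Seq ≃ₗᵢ[ℝ] L2Unit,
        (∀ ξ : L2Seq, Filter.Tendsto
          (fun F : Finset Idx => MeasureTheory.eLpNorm
            (fun t => Φ ξ t - ∑ i ∈ F, phi P Γ α i t * ξ i) 2
            (MeasureTheory.volume.restrict (Set.Icc (0 : ℝ) 1)))
          Filter.atTop (nhds 0)) ∧
        ∃ R : L2Unit →L[ℝ] L2Unit,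
          (∀ x : L2Unit, ∀ᵐ t ∂(MeasureTheory.volume.restrict (Set.Icc (0 : ℝ) 1)),
            R x t = ∫ s in (0 : ℝ)..1, kernel Γ α β t s * x s) ∧
          ContinuousLinearMap.adjoint G ∘L G - ContinuousLinearMap.id ℝ L2Seq
            = (Φ.symm : L2Unit →L[ℝ] L2Seq) ∘L R ∘L (Φ : L2Seq →L[ℝ] L2Unit) := by
  have Hα : Regular Γ α := ⟨hα.continuousOn, hΓ.continuousOn, hΓpos⟩
  have Hβ : Regular Γ β := ⟨hβ.continuousOn, hΓ.continuousOn, hΓpos⟩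
  refine ⟨Hα.tendstoUniformlyOn_construction P, ?_⟩
  -- Global stand-ins for (α - β)/f_α, f_α and the profile V; all integrals below see only [0,1].
  obtain ⟨w, cw, ⟨A, hA⟩, ew⟩ := exists_extension (continuousOn_drift_div Hα Hβ)
  obtain ⟨F, cF, ⟨M, hM⟩, eF⟩ := exists_extension Hα.continuousOn_f
  obtain ⟨V, cV, ⟨B, hB⟩, eV⟩ := exists_extension (continuousOn_kernelProfile Hα Hβ)
  have hB0 : 0 ≤ B := (abs_nonneg _).trans (hB 0)
  have hM0 : 0 ≤ M := (abs_nonneg _).trans (hM 0)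
  obtain ⟨C, θ, hC, h0, h1, hm⟩ := (hasDyadicModulus_kernelProfile Hα Hβ hα.hasDyadicModulus
    hβ.hasDyadicModulus hΓ.hasDyadicModulus).congr eV
  have D : DyadicData V F M C θ := ⟨cV, cF, hM, hC, h0, h1, hm⟩
  have hK := boundedKernel_volterra cw cF hA hM
  have hR : BoundedKernel (fun t s => V (max t s) * F t * F s) (B * M * M) := by
    refine ⟨Continuous.measurable (by fun_prop), fun t s => ?_⟩
    rw [abs_mul, abs_mul]
    have := hB (max t s)
    have := hM t
    have := hM s
    gcongr
  -- The condition V f = w + (∫ₜ¹ w²) f is the definition of the profile multiplied by f, since w² =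
  -- (α - β)²/f².
  have hsum := volterra_add_adjoint hK hR fun t ht => by
    have e : ∫ u in t..1, w u ^ 2 = ∫ u in t..1, (α u - β u) ^ 2 / f Γ α u ^ 2 :=
      intervalIntegral.integral_congr fun u hu => by
        rw [uIcc_of_le ht.2] at hu
        rw [ew u ⟨ht.1.trans hu.1, hu.2⟩, div_pow]
    have := (Hα.f_pos ht).ne'
    rw [e, eV t ht, eF t ht, ew t ht, kernelProfile]
    field_simp
  set A' := (Hα.basis P).repr.symm
  set B' := (Hβ.basis P).repr.symm
  have hS := adjoint_comp_sub_id A' B' hK.op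
  rw [hsum] at hS
  have hnuc := (D.isNuclearWithTrace_op hR).conj A'
  have htr : ∫ t in Icc (0 : ℝ) 1, V t * F t ^ 2 = (∫ t in (0 : ℝ)..1, (α t - β t))
      + ∫ t in (0 : ℝ)..1, h Γ α t / f Γ α t ^ 2 * (α t - β t) ^ 2 := by
    rw [← integral_kernelProfile Hα Hβ, integral_unit_eq]
    refine intervalIntegral.integral_congr fun t ht => ?_
    rw [uIcc_of_le zero_le_one] at ht
    rw [eV t ht, eF t ht]
  rw [← hS, htr] at hnuc
  -- G is read off from `hS`: it is B'⁻¹ (1 + K) A', bounded by construction. What remains is that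
  -- its entries are Δ_β Ψ_α and that R has the stated kernel.
  refine ⟨_, fun ξ i => ?_, hnuc.isTraceClass, hnuc.hasTrace, A', Hα.tendsto_eLpNorm P, hR.op,
    fun x => ?_, hS⟩
  · have hz : ∀ᵐ t ∂volume.restrict (Icc (0 : ℝ) 1), (A' ξ + hK.op (A' ξ)) t
        = A' ξ t + (α t - β t) / f Γ α t * ∫ s in (0 : ℝ)..t, f Γ α s * A' ξ s := by
      filter_upwards [Lp.coeFn_add (A' ξ) (hK.op (A' ξ)), coeFn_volterra_op hK (A' ξ),
        ae_restrict_mem measurableSet_Icc] with t h2 h3 ht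
      rw [h2, Pi.add_apply, h3, ew t ht]
      congr 2
      refine intervalIntegral.integral_congr fun s hs => ?_
      rw [eF s (uIcc_subset_Icc (by simp) ht hs)]
    -- The entry is the pairing of the β-function φ_i with z = (1 + K) A' ξ, hence a β-coefficient
    -- of the path g_β ∫₀ f_β z, which is Ψ_α(ξ).
    change (Hβ.basis P).repr (A' ξ + hK.op (A' ξ)) i = _
    rw [HilbertBasis.repr_apply_apply, Hβ.basis_apply, Hβ.inner_phiLp]
    refine coefficient_congr P Γ β (fun t ht => ?_) i
    rw [g_mul_primitive_eq Hα Hβ hz ht, Hα.construction_eq P ξ ht, Hα.inner_cutoffLp ht]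
  · filter_upwards [hR.coeFn_op x, ae_restrict_mem measurableSet_Icc] with t h2 ht
    rw [h2, integral_unit_eq]
    refine intervalIntegral.integral_congr fun s hs => ?_
    rw [uIcc_of_le zero_le_one] at hs
    have hmax : max t s ∈ Icc (0 : ℝ) 1 := ⟨ht.1.trans (le_max_left _ _), max_le ht.2 hs.2⟩
    rw [kernel_eq Hα β ht hs, eV _ hmax, eF t ht, eF s hs]
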